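/- Let $n\ge 1$, let $\Omega\subset\mathbb{R}^n$ be an open set, let $1<p<\infty$, and let $m$ be a positive integer. For an integer $k\ge 0$, the Sobolev space $W^{k,p}(\Omega)$ consists of all real-valued $u\in L^p(\Omega)$ such that for every multi-index $\alpha$ with $|\alpha|\le k$ the weak derivative $D^\alpha u$ exists and belongs to $L^p(\Omega)$; thus $W^{0,p}(\Omega)=L^p(\Omega)$, and $D^0u=u$. Let $(\rho_\varepsilon)_{\varepsilon>0}$ be a family of functions $\rho_\varepsilon\in L^1_{\rm loc}(0,\infty)$ with $\rho_\varepsilon\ge 0$, \[ \int_0^\infty\rho_\varepsilon(r)\,r^{n-1}\,dr=1\quad\text{for every }\varepsilon>0, \qquad \lim_{\varepsilon\to 0}\int_\delta^\infty\rho_\varepsilon(r)\,r^{n-1}\,dr=0\quad\text{for every }\delta>0 . \] For $f\in W^{m-1,p}(\Omega)$ let \[ R^{m-1}f(x,y)=f(x)-\sum_{|\alpha|\le m-1}D^\alpha f(y)\,\frac{(x-y)^\alpha}{\alpha!},\qquad x,y\in\Omega, \] be the Taylor remainder formed with the weak derivatives of $f$. If $f\in W^{m-1,p}(\Omega)$ satisfies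 \[ \liminf_{\varepsilon\to 0}\int_\Omega\int_\Omega\frac{|R^{m-1}f(x,y)|^p}{|x-y|^{mp}}\,\rho_\varepsilon(|x-y|)\,dx\,dy<\infty , \] then $f\in W^{m,p}(\Omega)$. -/

import Mathlib

open MeasureTheory Filter Topology Set
open scoped ContDiff ENNReal

namespace HigherSobolev

noncomputable section

/-- The order `|α| = α₁ + ⋯ + αₙ` of a multi-index. -/
def order {n : ℕ} (α : Fin n → ℕ) : ℕ := ∑ i, α i

/-- The factorial `α! = α₁! ⋯ αₙ!` of a multi-index. -/
def multiFactorial {n : ℕ} (α : Fin n → ℕ) : ℕ := ∏ i, (α i).factorial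

/-- The monomial `x ^ α = x₁ ^ α₁ ⋯ xₙ ^ αₙ`. -/
def monomial {n : ℕ} (α : Fin n → ℕ) (x : EuclideanSpace ℝ (Fin n)) : ℝ := ∏ i, x i ^ α i

/-- The finite set of the multi-indices of order at most `k`
(each entry of such a multi-index is at most `k`). -/
def multiIndices (n k : ℕ) : Finset (Fin n → ℕ) :=
  (Fintype.piFinset fun _ : Fin n => Finset.range (k + 1)).filter fun α => order α ≤ k

theorem mem_multiIndices {n k : ℕ} {α : Fin n → ℕ} :
    α ∈ multiIndices n k ↔ order α ≤ k := by
  simp only [multiIndices, Finset.mem_filter, Fintype.mem_piFinset, Finset.mem_range,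
    and_iff_right_iff_imp]
  intro h i
  exact Nat.lt_succ_of_le
    ((Finset.single_le_sum (f := α) (fun j _ => Nat.zero_le _) (Finset.mem_univ i)).trans h)

/-- The classical partial derivative `∂φ/∂xᵢ`. -/
def partialDeriv {n : ℕ} (i : Fin n) (φ : EuclideanSpace ℝ (Fin n) → ℝ) :
    EuclideanSpace ℝ (Fin n) → ℝ :=
  fun x => fderiv ℝ φ x (EuclideanSpace.single i 1)

/-- The classical derivative `D^α φ = ∂₁^α₁ ⋯ ∂ₙ^αₙ φ`; it is only applied to smooth functions. -/
def multiDeriv {n : ℕ} (α : Fin n → ℕ) (φ : EuclideanSpace ℝ (Fin n) → ℝ) :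
    EuclideanSpace ℝ (Fin n) → ℝ :=
  (List.finRange n).foldr (fun i ψ => (partialDeriv i)^[α i] ψ) φ

/-- `φ ∈ C₀^∞(Ω)`: smooth with compact support contained in `Ω`. -/
structure IsTestFunction {n : ℕ} (Ω : Set (EuclideanSpace ℝ (Fin n)))
    (φ : EuclideanSpace ℝ (Fin n) → ℝ) : Prop where
  smooth : ContDiff ℝ ∞ φ
  compact_support : HasCompactSupport φ
  support_subset : tsupport φ ⊆ Ω

/-- `g` is a weak derivative `D^α f` of `f` in the open set `Ω`. -/
structure IsWeakDeriv {n : ℕ} (Ω : Set (EuclideanSpace ℝ (Fin n))) (α : Fin n → ℕ)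
    (f g : EuclideanSpace ℝ (Fin n) → ℝ) : Prop where
  locallyIntegrableOn : LocallyIntegrableOn f Ω volume
  locallyIntegrableOn_deriv : LocallyIntegrableOn g Ω volume
  integral_eq : ∀ φ : EuclideanSpace ℝ (Fin n) → ℝ, IsTestFunction Ω φ →
    ∫ x in Ω, f x * multiDeriv α φ x = (-1) ^ order α * ∫ x in Ω, g x * φ x

/-- `f ∈ W^{k,p}(Ω)`: `f ∈ L^p(Ω)` and every weak derivative of order at most `k` exists and
belongs to `L^p(Ω)`. -/
def MemSobolev {n : ℕ} (k : ℕ) (p : ℝ) (Ω : Set (EuclideanSpace ℝ (Fin n)))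
    (f : EuclideanSpace ℝ (Fin n) → ℝ) : Prop :=
  MemLp f (ENNReal.ofReal p) (volume.restrict Ω) ∧
    ∀ α : Fin n → ℕ, order α ≤ k →
      ∃ g, IsWeakDeriv Ω α f g ∧ MemLp g (ENNReal.ofReal p) (volume.restrict Ω)

open Classical in
/-- A representative of the weak derivative `D^α f` in `Ω` (unique up to null sets), with the
convention `D^0 f = f`; the value `0` is a dummy for a weak derivative that does not exist. -/
def weakDeriv {n : ℕ} (Ω : Set (EuclideanSpace ℝ (Fin n))) (α : Fin n → ℕ)
    (f : EuclideanSpace ℝ (Fin n) → ℝ) : EuclideanSpace ℝ (Fin n) → ℝ :=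
  if α = 0 then f else if h : ∃ g, IsWeakDeriv Ω α f g then h.choose else 0

/-- The Taylor polynomial `T_y^k f(x) = ∑_{|α| ≤ k} D^α f(y) (x - y)^α / α!`. -/
def taylorPoly {n : ℕ} (Ω : Set (EuclideanSpace ℝ (Fin n))) (k : ℕ)
    (f : EuclideanSpace ℝ (Fin n) → ℝ) (y x : EuclideanSpace ℝ (Fin n)) : ℝ :=
  ∑ α ∈ multiIndices n k, weakDeriv Ω α f y * monomial α (x - y) / multiFactorial α

/-- The Taylor remainder `R^k f(x, y) = f(x) - T_y^k f(x)`. -/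
def taylorRemainder {n : ℕ} (Ω : Set (EuclideanSpace ℝ (Fin n))) (k : ℕ)
    (f : EuclideanSpace ℝ (Fin n) → ℝ) (x y : EuclideanSpace ℝ (Fin n)) : ℝ :=
  f x - taylorPoly Ω k f y x

/-- The family `ρ ε`, `ε > 0`, consists of the radial profiles of mollifiers on `ℝⁿ`. (The
integral in `integral_eq_one` is not `0`, hence its integrand is integrable on `(0, ∞)`.) -/
structure IsRadialMollifier (n : ℕ) (ρ : ℝ → ℝ → ℝ) : Prop where
  locallyIntegrableOn : ∀ ε > 0, LocallyIntegrableOn (ρ ε) (Ioi 0) volume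
  nonneg : ∀ ε > 0, ∀ᵐ r ∂(volume.restrict (Ioi (0 : ℝ))), 0 ≤ ρ ε r
  integral_eq_one : ∀ ε > 0, ∫ r in Ioi (0 : ℝ), ρ ε r * r ^ (n - 1) = 1
  tendsto_zero : ∀ δ > 0,
    Tendsto (fun ε => ∫ r in Ioi δ, ρ ε r * r ^ (n - 1)) (𝓝[>] 0) (𝓝 0)

/-- The functional
`∫_Ω ∫_Ω |R^{m-1} f(x,y)|^p / |x-y|^{mp} ρ(|x-y|) dx dy`, with values in `[0, ∞]`. -/
def remainderEnergy {n : ℕ} (Ω : Set (EuclideanSpace ℝ (Fin n))) (m : ℕ) (p : ℝ) (ρ : ℝ → ℝ)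
    (f : EuclideanSpace ℝ (Fin n) → ℝ) : ℝ≥0∞ :=
  ∫⁻ y in Ω, ∫⁻ x in Ω,
    ENNReal.ofReal (|taylorRemainder Ω (m - 1) f x y| ^ p / ‖x - y‖ ^ ((m : ℝ) * p) * ρ ‖x - y‖)

end

end HigherSobolev

/-!
The proof is by duality and needs no regularization of `f`. Write `m = k + 1`, let `q` be the exponent
conjugate to `p`, let `φ` be a test function in `Ω`, and fix a multi-index `β` of order `m`.

Let `P` be a homogeneous polynomial of degree `m` whose integral over the unit sphere against the
monomial `θ ^ α`, `|α| = m`, is `1` for `α = β` and `0` otherwise (`exists_dual_polynomial`; it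
exists because the Gram matrix of the monomials of degree `m` on the sphere is invertible), and
consider, for the profile `κ_ε` truncated to a small ball, the pairing
`∫ κ_ε(|h|) P(h/|h|) |h|^{-m} ∫ R^{m-1} f(y + h, y) φ(y) dy dh`.

On the one hand, Hölder's inequality bounds it by the `p`-th root of the energy times a constant
times the `L^q` norm of `φ` (`enorm_integral_kernel_mul_le`). On the other hand, translating
`f(y + h)` and integrating the weak derivatives by parts turns the inner integral into the pairing
of `f` with the Taylor remainder of order `m - 1` of `φ`, taken at `y` with increment `-h`
(`integral_remainder_mul_testFunction`). As `φ` is smooth, this is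
`∑_{|α| = m} (∫ f D^α φ) (-h)^α / α!` up to `O(|h|^{m+1})` (`exists_integral_remainder_bound`).
Since the mass of `κ_ε` concentrates at the origin, the choice of `P` makes the pairing converge to
`(-1)^m / β! ∫ f D^β φ` (`IsRadialMollifier.tendsto_integral_dual`).

Comparing the two along parameters with bounded energy gives `|∫ f D^β φ| ≤ B ‖φ‖_q`
with `B` independent of `φ` (`exists_bound_integral_mul_multiDeriv`). By the Hahn–Banach theorem and
the Riesz representation of the dual of `L^q` (`exists_memLp_representation`, proved here from the
Radon–Nikodym theorem), `D^β f` is a function in `L^p(Ω)`.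
-/

namespace HigherSobolev

/-! ### The dual of `L^q` -/

section LpDuality

open scoped NNReal

variable {X : Type*} [MeasurableSpace X] {μ : Measure X} {p q : ℝ≥0∞}

/-- The signed measure `E ↦ Λ 1_E` attached to a bounded functional `Λ` on `L^q` of a finite
measure. -/
noncomputable def dualSignedMeasure [IsFiniteMeasure μ] [Fact (1 ≤ q)] (hq : q ≠ ⊤)
    (Λ : StrongDual ℝ (Lp ℝ q μ)) : SignedMeasure X where
  measureOf' s := open Classical in
    if hs : MeasurableSet s then Λ (indicatorConstLp q hs (measure_ne_top μ s) 1) else 0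
  empty' := by
    rw [dif_pos MeasurableSet.empty]
    simp
  not_measurable' s hs := dif_neg hs
  m_iUnion' f hf hd := by
    classical
    have hU : MeasurableSet (⋃ i, f i) := MeasurableSet.iUnion hf
    have hq0 : 0 < q.toReal :=
      ENNReal.toReal_pos (zero_lt_one.trans_le Fact.out).ne' hq
    simp only [dif_pos hU, dif_pos (hf _)]
    have hfin : ∀ F : Finset ℕ,
        ∑ i ∈ F, Λ (indicatorConstLp q (hf i) (measure_ne_top μ _) (1 : ℝ))
          = Λ (indicatorConstLp q (Finset.measurableSet_biUnion F fun i _ => hf i)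
              (measure_ne_top μ _) (1 : ℝ)) := by
      intro F
      induction F using Finset.induction_on with
      | empty => simp
      | insert a F ha ih =>
        rw [Finset.sum_insert ha, ih, ← map_add, ← indicatorConstLp_disjoint_union]
        · congr 2
          simp
        · rw [Set.disjoint_iUnion₂_right]
          intro i hi
          exact hd (by rintro rfl; exact ha hi)
    have hreal : HasSum (fun i => μ.real (f i)) (μ.real (⋃ i, f i)) := by
      have h1 : ∑' i, μ (f i) = μ (⋃ i, f i) := (measure_iUnion hd hf).symm
      have h2 : ∑' i, μ (f i) ≠ ⊤ := h1 ▸ measure_ne_top μ _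
      have := (ENNReal.hasSum_toReal h2)
      rwa [← ENNReal.tsum_toReal_eq (fun i => measure_ne_top μ _), h1] at this
    -- the tail of the series is the value of `Λ` at the indicator of the remaining union, whose
    -- `L^q` norm is a power of the remaining measure
    have htail : Tendsto (fun F : Finset ℕ =>
        ‖Λ‖ * (μ.real (⋃ i, f i) - ∑ i ∈ F, μ.real (f i)) ^ (1 / q.toReal)) atTop (𝓝 0) := by
      have h1 : Tendsto (fun F : Finset ℕ => μ.real (⋃ i, f i) - ∑ i ∈ F, μ.real (f i)) atTop
          (𝓝 0) := by
        have := hreal.const_sub (μ.real (⋃ i, f i))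
        simpa using this
      have h2 := (h1.rpow_const (p := 1 / q.toReal) (Or.inr (by positivity))).const_mul ‖Λ‖
      rwa [Real.zero_rpow (by positivity), mul_zero] at h2
    rw [HasSum, SummationFilter.unconditional_filter, tendsto_iff_dist_tendsto_zero]
    refine squeeze_zero (fun _ => dist_nonneg) (fun F => ?_) htail
    have hF : MeasurableSet (⋃ i ∈ F, f i) := Finset.measurableSet_biUnion F fun i _ => hf i
    have hsub : (⋃ i ∈ F, f i) ⊆ ⋃ i, f i := Set.iUnion₂_subset fun i _ => Set.subset_iUnion f i
    have hsplit : indicatorConstLp q hU (measure_ne_top μ _) (1 : ℝ)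
        = indicatorConstLp q hF (measure_ne_top μ _) (1 : ℝ)
          + indicatorConstLp q (hU.diff hF) (measure_ne_top μ _) (1 : ℝ) := by
      rw [← indicatorConstLp_disjoint_union hF (hU.diff hF) _ _ disjoint_sdiff_right]
      congr 1
      exact (Set.union_sdiff_cancel hsub).symm
    have hmeas : μ.real ((⋃ i, f i) \ ⋃ i ∈ F, f i)
        = μ.real (⋃ i, f i) - ∑ i ∈ F, μ.real (f i) := by
      rw [measureReal_sdiff hsub hF, measureReal_biUnion_finset (hd.set_pairwise _) fun i _ => hf i]
    rw [hfin, hsplit, map_add, dist_eq_norm, sub_add_cancel_left, norm_neg]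
    refine (Λ.le_opNorm _).trans ?_
    rw [norm_indicatorConstLp (zero_lt_one.trans_le Fact.out).ne' hq, hmeas, norm_one, one_mul]

theorem dualSignedMeasure_apply [IsFiniteMeasure μ] [Fact (1 ≤ q)] (hq : q ≠ ⊤)
    (Λ : StrongDual ℝ (Lp ℝ q μ)) {s : Set X} (hs : MeasurableSet s) :
    dualSignedMeasure hq Λ s = Λ (indicatorConstLp q hs (measure_ne_top μ s) 1) :=
  dif_pos hs

/-- A bounded functional on `L^q` of a finite measure is given on simple functions by
integration against an integrable density. -/
theorem exists_integrable_density [IsFiniteMeasure μ] [Fact (1 ≤ q)] (hq : q ≠ ⊤)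
    (Λ : StrongDual ℝ (Lp ℝ q μ)) :
    ∃ h : X → ℝ, Measurable h ∧ Integrable h μ ∧
      ∀ (u : SimpleFunc X ℝ) (hu : MemLp u q μ), Λ (hu.toLp u) = ∫ x, u x * h x ∂μ := by
  set ν := dualSignedMeasure hq Λ with hν
  have hac : ν ≪ᵥ μ.toENNRealVectorMeasure := by
    refine VectorMeasure.AbsolutelyContinuous.mk fun s hs h0 => ?_
    rw [Measure.toENNRealVectorMeasure_apply_measurable hs] at h0
    rw [hν, dualSignedMeasure_apply hq Λ hs]
    have : indicatorConstLp q hs (measure_ne_top μ s) (1 : ℝ) = 0 := by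
      rw [← norm_eq_zero, norm_indicatorConstLp (zero_lt_one.trans_le Fact.out).ne' hq]
      have hq0 : 0 < q.toReal :=
        ENNReal.toReal_pos (zero_lt_one.trans_le Fact.out).ne' hq
      simp [measureReal_def, h0, hq0.ne']
    rw [this, map_zero]
  refine ⟨ν.rnDeriv μ, SignedMeasure.measurable_rnDeriv ν μ,
    SignedMeasure.integrable_rnDeriv ν μ, ?_⟩
  have hint := SignedMeasure.integrable_rnDeriv ν μ
  have hRN := SignedMeasure.withDensityᵥ_rnDeriv_eq ν μ hac
  have hset : ∀ s (hs : MeasurableSet s),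
      Λ (indicatorConstLp q hs (measure_ne_top μ s) 1) = ∫ x in s, ν.rnDeriv μ x ∂μ := by
    intro s hs
    rw [← dualSignedMeasure_apply hq Λ hs, ← hν, ← withDensityᵥ_apply hint hs, hRN]
  intro u
  have hbdd : ∀ u : SimpleFunc X ℝ, MemLp u q μ := fun u => SimpleFunc.memLp_of_isFiniteMeasure u q μ
  have hmul : ∀ u : SimpleFunc X ℝ, Integrable (fun x => u x * ν.rnDeriv μ x) μ := by
    intro u
    obtain ⟨C, hC⟩ := u.exists_forall_norm_le
    exact hint.bdd_mul (c := C) u.aestronglyMeasurable (Eventually.of_forall hC)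
  induction u using SimpleFunc.induction with
  | @const c s hs =>
    intro hu
    have : hu.toLp _ = c • indicatorConstLp q hs (measure_ne_top μ s) (1 : ℝ) := by
      rw [indicatorConstLp, ← MemLp.toLp_const_smul]
      refine MemLp.toLp_congr _ _ (Eventually.of_forall fun x => ?_)
      by_cases hx : x ∈ s <;> simp [hx]
    rw [this, map_smul, hset s hs, smul_eq_mul, ← integral_const_mul,
      ← integral_indicator hs]
    refine integral_congr_ae (Eventually.of_forall fun x => ?_)
    by_cases hx : x ∈ s <;> simp [hx]
  | @add u v _ h1 h2 =>
    intro hu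
    have : hu.toLp _ = (hbdd u).toLp u + (hbdd v).toLp v := rfl
    rw [this, map_add, h1, h2, ← integral_add (hmul u) (hmul v)]
    simp [add_mul]

/-- The density of a bounded functional on `L^q` of a finite measure lies in `L^p`: test the
functional on simple functions `φ^{1/q} sign h` with `φ ≤ |h|^p`. -/
theorem exists_memLp_density [IsFiniteMeasure μ] [Fact (1 ≤ q)] [p.HolderConjugate q]
    (hp : p ≠ ⊤) (hq : q ≠ ⊤) (Λ : StrongDual ℝ (Lp ℝ q μ)) :
    ∃ h : X → ℝ, MemLp h p μ ∧
      ∀ (u : SimpleFunc X ℝ) (hu : MemLp u q μ), Λ (hu.toLp u) = ∫ x, u x * h x ∂μ := by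
  obtain ⟨h, hmeas, hint, hΛ⟩ := exists_integrable_density hq Λ
  refine ⟨h, ⟨hmeas.aestronglyMeasurable, ?_⟩, hΛ⟩
  have hq1 : q ≠ 0 := (zero_lt_one.trans_le Fact.out).ne'
  have hp1 : p ≠ 0 := ENNReal.HolderConjugate.ne_zero p q
  have hpq : p.toReal.HolderConjugate q.toReal := ENNReal.HolderConjugate.toReal_of_ne_top hp hq
  have hp0 := hpq.pos
  have hq0 := hpq.symm.pos
  rw [eLpNorm_lt_top_iff_lintegral_rpow_enorm_lt_top hp1 hp]
  refine lt_of_le_of_lt ?_ (ENNReal.ofReal_lt_top (r := ‖Λ‖ ^ p.toReal))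
  rw [lintegral_eq_nnreal]
  refine iSup₂_le fun φ hφ => ?_
  -- `sg` is the sign of `h`, and `u` the test function `φ^{1/q} sign h`
  let sg : SimpleFunc X ℝ := SimpleFunc.piecewise {x | 0 ≤ h x}
    (measurableSet_le measurable_const hmeas) (SimpleFunc.const X 1) (SimpleFunc.const X (-1))
  let u : SimpleFunc X ℝ := (φ.map fun t : ℝ≥0 => (t : ℝ) ^ (1 / q.toReal)) * sg
  have hu : MemLp u q μ := SimpleFunc.memLp_of_isFiniteMeasure u q μ
  have hsg : ∀ x, sg x * h x = |h x| := by
    intro x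
    by_cases hx : 0 ≤ h x
    · simp [sg, SimpleFunc.piecewise_apply, hx, abs_of_nonneg hx]
    · simp [sg, SimpleFunc.piecewise_apply, hx, abs_of_neg (not_le.mp hx)]
  have hsg1 : ∀ x, |sg x| = 1 := by
    intro x
    by_cases hx : 0 ≤ h x <;> simp [sg, SimpleFunc.piecewise_apply, hx]
  have hφint : Integrable (fun x => (φ x : ℝ)) μ :=
    (SimpleFunc.integrable_of_isFiniteMeasure (φ.map ((↑) : ℝ≥0 → ℝ)))
  have hlin : (φ.map ((↑) : ℝ≥0 → ℝ≥0∞)).lintegral μ = ENNReal.ofReal (∫ x, (φ x : ℝ) ∂μ) := by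
    rw [ofReal_integral_eq_lintegral_ofReal hφint (Eventually.of_forall fun x => (φ x).coe_nonneg),
      ← SimpleFunc.lintegral_eq_lintegral]
    simp
  have hI : 0 ≤ ∫ x, (φ x : ℝ) ∂μ := integral_nonneg fun x => (φ x).coe_nonneg
  rw [hlin]
  refine ENNReal.ofReal_le_ofReal ?_
  set I := ∫ x, (φ x : ℝ) ∂μ with hIdef
  have hpt : ∀ x, (φ x : ℝ) ≤ u x * h x := by
    intro x
    have h1 : u x * h x = (φ x : ℝ) ^ (1 / q.toReal) * |h x| := by
      rw [← hsg x]
      simp [u, mul_assoc]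
    have h2 : (φ x : ℝ) ≤ |h x| ^ p.toReal := by
      have := hφ x
      rw [← enorm_norm, Real.enorm_eq_ofReal (norm_nonneg _),
        ENNReal.ofReal_rpow_of_nonneg (norm_nonneg _) hp0.le, ← ENNReal.ofReal_coe_nnreal,
        ENNReal.ofReal_le_ofReal_iff (by positivity)] at this
      simpa using this
    have h3 : (φ x : ℝ) ^ (1 / p.toReal) ≤ |h x| := by
      rw [one_div, Real.rpow_inv_le_iff_of_pos (φ x).coe_nonneg (abs_nonneg _) hp0]
      exact h2
    rw [h1]
    calc (φ x : ℝ) = (φ x : ℝ) ^ (1 / q.toReal) * (φ x : ℝ) ^ (1 / p.toReal) := by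
          rw [← Real.rpow_add_of_nonneg (φ x).coe_nonneg (by positivity) (by positivity)]
          rw [one_div, one_div, hpq.symm.inv_add_inv_eq_one, Real.rpow_one]
      _ ≤ _ := by gcongr
  have hI1 : I ≤ Λ (hu.toLp u) := by
    rw [hΛ u hu]
    refine integral_mono hφint ?_ hpt
    obtain ⟨C, hC⟩ := u.exists_forall_norm_le
    exact hint.bdd_mul (c := C) u.aestronglyMeasurable (Eventually.of_forall hC)
  have hnorm : ‖hu.toLp u‖ = I ^ (1 / q.toReal) := by
    rw [Lp.norm_toLp, hu.eLpNorm_eq_integral_rpow_norm hq1 hq, ENNReal.toReal_ofReal]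
    · congr 1
      · refine integral_congr_ae (Eventually.of_forall fun x => ?_)
        have : ‖u x‖ = (φ x : ℝ) ^ (1 / q.toReal) := by
          simp only [u, SimpleFunc.coe_mul, SimpleFunc.coe_map, Pi.mul_apply, Function.comp_apply,
            norm_mul, Real.norm_eq_abs, hsg1, mul_one]
          exact abs_of_nonneg (by positivity)
        simp only [this]
        rw [← Real.rpow_mul (φ x).coe_nonneg, one_div, inv_mul_cancel₀ hq0.ne', Real.rpow_one]
      · rw [one_div]
    · exact Real.rpow_nonneg (integral_nonneg fun x => by positivity) _
  have hI2 : I ≤ ‖Λ‖ * I ^ (1 / q.toReal) :=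
    hI1.trans ((le_abs_self _).trans ((Λ.le_opNorm _).trans_eq (by rw [hnorm])))
  rcases hI.eq_or_lt with h0 | hpos
  · rw [← h0]; positivity
  · have h4 : I ^ (1 / p.toReal) ≤ ‖Λ‖ := by
      have h5 : I = I ^ (1 / p.toReal) * I ^ (1 / q.toReal) := by
        rw [← Real.rpow_add hpos, one_div, one_div, hpq.inv_add_inv_eq_one, Real.rpow_one]
      have h6 : 0 < I ^ (1 / q.toReal) := Real.rpow_pos_of_pos hpos _
      refine le_of_mul_le_mul_right ?_ h6
      rwa [← h5]
    calc I = (I ^ (1 / p.toReal)) ^ p.toReal := by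
          rw [← Real.rpow_mul hI, one_div, inv_mul_cancel₀ hp0.ne', Real.rpow_one]
      _ ≤ _ := Real.rpow_le_rpow (by positivity) h4 hp0.le

/-- The Riesz representation of the dual of `L^q` for a finite measure. -/
theorem exists_memLp_representation_of_isFiniteMeasure [IsFiniteMeasure μ] [Fact (1 ≤ q)]
    [Fact (1 ≤ p)] [p.HolderConjugate q] (hp : p ≠ ⊤) (hq : q ≠ ⊤)
    (Λ : StrongDual ℝ (Lp ℝ q μ)) :
    ∃ h : X → ℝ, MemLp h p μ ∧ ∀ u : Lp ℝ q μ, Λ u = ∫ x, u x * h x ∂μ := by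
  obtain ⟨h, hmem, hΛ⟩ := exists_memLp_density hp hq Λ
  refine ⟨h, hmem, fun u => ?_⟩
  let B := (ContinuousLinearMap.lsmul ℝ ℝ : ℝ →L[ℝ] ℝ →L[ℝ] ℝ)
  let Ψ : StrongDual ℝ (Lp ℝ q μ) := B.lpPairing μ p q (hmem.toLp h)
  have hΨ : ∀ u : Lp ℝ q μ, Ψ u = ∫ x, u x * h x ∂μ := by
    intro u
    rw [ContinuousLinearMap.lpPairing_eq_integral]
    refine integral_congr_ae ?_
    filter_upwards [hmem.coeFn_toLp] with x hx
    simp [B, hx, mul_comm]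
  have hEq : Set.EqOn Λ Ψ (Set.range ((↑) : Lp.simpleFunc ℝ q μ → Lp ℝ q μ)) := by
    rintro _ ⟨s, rfl⟩
    have hs : MemLp (Lp.simpleFunc.toSimpleFunc s) q μ :=
      SimpleFunc.memLp_of_isFiniteMeasure _ q μ
    have h1 : (s : Lp ℝ q μ) = hs.toLp _ :=
      (congrArg Subtype.val (Lp.simpleFunc.toLp_toSimpleFunc s)).symm
    rw [hΨ, h1, hΛ]
    refine integral_congr_ae ?_
    filter_upwards [hs.coeFn_toLp] with x hx
    rw [hx]
  have := (Lp.simpleFunc.denseRange (E := ℝ) (μ := μ) hq)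
  rw [← hΨ, Continuous.ext_on this Λ.continuous Ψ.continuous hEq]

/-- A functional vanishing on the kernel of `ι` descends to the range of `ι`. -/
theorem exists_linearMap_range_eq {V W : Type*} [AddCommGroup V] [Module ℝ V] [AddCommGroup W]
    [Module ℝ W] (ι : V →ₗ[ℝ] W) (T : V →ₗ[ℝ] ℝ) (h : LinearMap.ker ι ≤ LinearMap.ker T) :
    ∃ T' : LinearMap.range ι →ₗ[ℝ] ℝ, ∀ v, T' ⟨ι v, v, rfl⟩ = T v := by
  refine ⟨(LinearMap.ker ι).liftQ T h ∘ₗ ι.quotKerEquivRange.symm, fun v => ?_⟩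
  rw [LinearMap.comp_apply]
  have : ι.quotKerEquivRange.symm ⟨ι v, v, rfl⟩ = (LinearMap.ker ι).mkQ v :=
    ι.quotKerEquivRange_symm_apply_image v _
  rw [LinearEquiv.coe_coe, this, Submodule.mkQ_apply, Submodule.liftQ_apply]

/-- **Riesz representation** for subspaces: a linear functional on a space `V` of functions,
bounded for the `L^q` seminorm, is integration against a function in `L^p`. The σ-finite case is
reduced to a finite measure `w μ` by the isometry `u ↦ u w^{1/q}` from `L^q(w μ)` to `L^q(μ)`. -/
theorem exists_memLp_representation [SigmaFinite μ] {p q : ℝ} (hpq : p.HolderConjugate q)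
    (V : Submodule ℝ (X → ℝ)) (hV : ∀ v ∈ V, MemLp v (ENNReal.ofReal q) μ)
    (T : V →ₗ[ℝ] ℝ) (C : ℝ)
    (hT : ∀ v : V, |T v| ≤ C * (eLpNorm v.1 (ENNReal.ofReal q) μ).toReal) :
    ∃ g, MemLp g (ENNReal.ofReal p) μ ∧ ∀ v : V, T v = ∫ x, v.1 x * g x ∂μ := by
  set Q := ENNReal.ofReal q with hQ
  set P := ENNReal.ofReal p with hP
  have hQt : Q ≠ ⊤ := ENNReal.ofReal_ne_top
  have hPt : P ≠ ⊤ := ENNReal.ofReal_ne_top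
  have hp0 := hpq.pos
  have hq0 := hpq.symm.pos
  have : Fact (1 ≤ Q) := ⟨by simpa [hQ] using hpq.symm.lt.le⟩
  have : Fact (1 ≤ P) := ⟨by simpa [hP] using hpq.lt.le⟩
  have : P.HolderConjugate Q := hpq.ennrealOfReal
  -- the functional on the image of `V` in `L^q`, and its norm preserving extension
  let ι : V →ₗ[ℝ] Lp ℝ Q μ :=
    { toFun := fun v => (hV v v.2).toLp v.1
      map_add' := fun _ _ => rfl
      map_smul' := fun _ _ => rfl }
  have hιn : ∀ v : V, ‖ι v‖ = (eLpNorm v.1 Q μ).toReal := fun v =>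
    Lp.norm_toLp _ (hV v v.2)
  obtain ⟨T₀, hT₀⟩ := exists_linearMap_range_eq ι T fun v hv => by
    have h := hT v
    rw [← hιn, LinearMap.mem_ker.mp hv, norm_zero, mul_zero] at h
    exact abs_eq_zero.mp (le_antisymm h (abs_nonneg _))
  let T' : StrongDual ℝ (LinearMap.range ι) := LinearMap.mkContinuous T₀ C <| by
    rintro ⟨_, v, rfl⟩
    rw [hT₀]
    exact (hT v).trans_eq (by rw [← hιn]; rfl)
  obtain ⟨Λ, hΛ, -⟩ := exists_extension_norm_eq (LinearMap.range ι) T'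
  have hΛT : ∀ v : V, Λ (ι v) = T v := fun v => (hΛ ⟨ι v, v, rfl⟩).trans (hT₀ v)
  -- the weight
  obtain ⟨w, hw0, hwm, hw1⟩ := exists_pos_lintegral_lt_of_sigmaFinite μ one_ne_zero
  set μ' := μ.withDensity fun x => (w x : ℝ≥0∞) with hμ'
  have : IsFiniteMeasure μ' := isFiniteMeasure_withDensity (hw1.trans ENNReal.one_lt_top).ne
  have hwm' : Measurable fun x => (w x : ℝ≥0∞) := hwm.coe_nnreal_ennreal
  have hac : μ ≪ μ' := withDensity_absolutelyContinuous' hwm'.aemeasurable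
    (Eventually.of_forall fun x => by simpa using (hw0 x).ne')
  have hac' : μ' ≪ μ := withDensity_absolutelyContinuous _ _
  have hnorm : ∀ (r : ℝ), 0 < r → ∀ u : X → ℝ, AEStronglyMeasurable u μ →
      eLpNorm (fun x => u x * (w x : ℝ) ^ (1 / r)) (ENNReal.ofReal r) μ
        = eLpNorm u (ENNReal.ofReal r) μ' := by
    intro r hr u hu
    have hr0 : ENNReal.ofReal r ≠ 0 := by simpa using hr
    rw [eLpNorm_eq_lintegral_rpow_enorm_toReal hr0 ENNReal.ofReal_ne_top,
      eLpNorm_eq_lintegral_rpow_enorm_toReal hr0 ENNReal.ofReal_ne_top,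
      ENNReal.toReal_ofReal hr.le, hμ',
      lintegral_withDensity_eq_lintegral_mul₀ hwm'.aemeasurable (hu.enorm.pow_const r)]
    congr 1
    refine lintegral_congr fun x => ?_
    have : ‖(w x : ℝ) ^ (1 / r)‖ₑ = (w x : ℝ≥0∞) ^ (1 / r) := by
      rw [Real.enorm_of_nonneg (by positivity),
        ← ENNReal.ofReal_rpow_of_nonneg (w x).coe_nonneg (by positivity),
        ENNReal.ofReal_coe_nnreal]
    rw [enorm_mul, this, ENNReal.mul_rpow_of_nonneg _ _ hr.le, ← ENNReal.rpow_mul, one_div,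
      inv_mul_cancel₀ hr.ne', ENNReal.rpow_one, Pi.mul_apply, mul_comm]
  have hwr : ∀ r : ℝ, AEStronglyMeasurable (fun x => (w x : ℝ) ^ r) μ := fun r =>
    (hwm.coe_nnreal_real.pow_const r).aestronglyMeasurable
  have hmem : ∀ r : ℝ, 0 < r → ∀ u : X → ℝ, MemLp u (ENNReal.ofReal r) μ' →
      MemLp (fun x => u x * (w x : ℝ) ^ (1 / r)) (ENNReal.ofReal r) μ := by
    intro r hr u hu
    have hu1 := hu.1.mono_ac hac
    exact ⟨hu1.mul (hwr _), (hnorm r hr u hu1).trans_lt hu.2⟩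
  let M : Lp ℝ Q μ' →ₗᵢ[ℝ] Lp ℝ Q μ :=
    { toFun := fun u => (hmem q hq0 u (Lp.memLp u)).toLp _
      map_add' := fun u v => by
        rw [← MemLp.toLp_add]
        refine MemLp.toLp_congr _ _ ?_
        filter_upwards [hac (Lp.coeFn_add u v)] with x hx
        simp only [hx, Pi.add_apply, add_mul]
      map_smul' := fun c u => by
        rw [RingHom.id_apply, ← MemLp.toLp_const_smul]
        refine MemLp.toLp_congr _ _ ?_
        filter_upwards [hac (Lp.coeFn_smul c u)] with x hx
        simp only [hx, Pi.smul_apply, smul_eq_mul, mul_assoc]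
      norm_map' := fun u => by
        simp only [LinearMap.coe_mk, AddHom.coe_mk, Lp.norm_toLp]
        rw [hnorm q hq0 u ((Lp.memLp u).1.mono_ac hac), Lp.norm_def] }
  obtain ⟨h, hh, hrep⟩ := exists_memLp_representation_of_isFiniteMeasure (p := P) hPt hQt
    (Λ.comp M.toContinuousLinearMap)
  refine ⟨fun x => h x * (w x : ℝ) ^ (1 / p), hmem p hp0 h hh, fun v => ?_⟩
  have hvm : AEStronglyMeasurable v.1 μ := (hV v v.2).1
  have hw1' : ∀ x, 0 < (w x : ℝ) := fun x => NNReal.coe_pos.mpr (hw0 x)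
  have hcancel : ∀ x (r : ℝ), v.1 x * (w x : ℝ) ^ (-r) * (w x : ℝ) ^ r = v.1 x := by
    intro x r
    rw [mul_assoc, ← Real.rpow_add (hw1' x), neg_add_cancel, Real.rpow_zero, mul_one]
  have hu : MemLp (fun x => v.1 x * (w x : ℝ) ^ (-(1 / q))) Q μ' := by
    have hum : AEStronglyMeasurable (fun x => v.1 x * (w x : ℝ) ^ (-(1 / q))) μ :=
      hvm.mul (hwr _)
    refine ⟨hum.mono_ac hac', ?_⟩
    rw [hQ, ← hnorm q hq0 _ hum]
    simp only [hcancel]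
    exact (hV v v.2).2
  have hMv : M (hu.toLp _) = ι v := by
    refine MemLp.toLp_congr (hmem q hq0 _ (Lp.memLp _)) (hV v v.2) ?_
    filter_upwards [hac hu.coeFn_toLp] with x hx
    rw [hx, hcancel]
  have h1 := hrep (hu.toLp _)
  rw [ContinuousLinearMap.comp_apply, LinearIsometry.coe_toContinuousLinearMap, hMv, hΛT] at h1
  have h2 : ∫ x, hu.toLp _ x * h x ∂μ' = ∫ x, v.1 x * (w x : ℝ) ^ (-(1 / q)) * h x ∂μ' := by
    refine integral_congr_ae ?_
    filter_upwards [hu.coeFn_toLp] with x hx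
    rw [hx]
  rw [h1, h2, hμ', integral_withDensity_eq_integral_smul hwm]
  refine integral_congr_ae (Eventually.of_forall fun x => ?_)
  simp only [NNReal.smul_def, smul_eq_mul]
  have : (w x : ℝ) * (w x : ℝ) ^ (-(1 / q)) = (w x : ℝ) ^ (1 / p) := by
    nth_rewrite 1 [← Real.rpow_one (w x : ℝ)]
    rw [← Real.rpow_add (hw1' x)]
    congr 1
    have := hpq.inv_add_inv_eq_one
    rw [one_div, one_div]
    linarith
  rw [← this]
  ring

end LpDuality

/-! ### Taylor expansion in multi-index form -/

section Taylor

variable {n : ℕ}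

/-- The space of smooth functions on `ℝⁿ`, on which the directional derivatives are commuting
endomorphisms. -/
def smoothFunctions (n : ℕ) : Submodule ℝ (EuclideanSpace ℝ (Fin n) → ℝ) where
  carrier := {φ | ContDiff ℝ ∞ φ}
  add_mem' h1 h2 := ContDiff.add (show ContDiff ℝ ∞ _ from h1) (show ContDiff ℝ ∞ _ from h2)
  zero_mem' := show ContDiff ℝ ∞ fun _ => (0 : ℝ) from contDiff_const
  smul_mem' _ _ h := ContDiff.smul contDiff_const (show ContDiff ℝ ∞ _ from h)

theorem contDiff_fderiv_apply {φ : EuclideanSpace ℝ (Fin n) → ℝ} (hφ : ContDiff ℝ ∞ φ)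
    (v : EuclideanSpace ℝ (Fin n)) : ContDiff ℝ ∞ fun x => fderiv ℝ φ x v :=
  (hφ.fderiv_right (m := ∞) (by simp)).clm_apply contDiff_const

/-- The derivative in the direction `v`, as an endomorphism of the space of smooth functions. -/
noncomputable def dirDeriv (v : EuclideanSpace ℝ (Fin n)) :
    Module.End ℝ (smoothFunctions n) where
  toFun φ := ⟨fun x => fderiv ℝ φ.1 x v, contDiff_fderiv_apply φ.2 v⟩
  map_add' φ ψ := by
    ext x
    have h1 : ContDiff ℝ ∞ φ.1 := φ.2
    have h2 : ContDiff ℝ ∞ ψ.1 := ψ.2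
    change fderiv ℝ (φ.1 + ψ.1) x v = fderiv ℝ φ.1 x v + fderiv ℝ ψ.1 x v
    rw [fderiv_add (h1.differentiable (by simp) x) (h2.differentiable (by simp) x)]
    rfl
  map_smul' c φ := by
    ext x
    have h1 : ContDiff ℝ ∞ φ.1 := φ.2
    change fderiv ℝ (c • φ.1) x v = c • fderiv ℝ φ.1 x v
    rw [fderiv_const_smul (h1.differentiable (by simp) x)]
    rfl

theorem dirDeriv_apply (v : EuclideanSpace ℝ (Fin n)) (φ : smoothFunctions n)
    (x : EuclideanSpace ℝ (Fin n)) : (dirDeriv v φ).1 x = fderiv ℝ φ.1 x v := rfl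

theorem commute_dirDeriv (v w : EuclideanSpace ℝ (Fin n)) :
    Commute (dirDeriv v) (dirDeriv w) := by
  have key : ∀ (v w : EuclideanSpace ℝ (Fin n)) (φ : smoothFunctions n)
      (x : EuclideanSpace ℝ (Fin n)),
      (dirDeriv v (dirDeriv w φ)).1 x = fderiv ℝ (fderiv ℝ φ.1) x v w := by
    intro v w φ x
    have h1 : ContDiff ℝ ∞ φ.1 := φ.2
    have h2 : DifferentiableAt ℝ (fderiv ℝ φ.1) x :=
      (h1.fderiv_right (m := ∞) (by simp)).differentiable (by simp) x
    change fderiv ℝ (fun y => fderiv ℝ φ.1 y w) x v = _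
    rw [fderiv_clm_apply h2 (differentiableAt_const w)]
    simp
  refine LinearMap.ext fun φ => Subtype.ext (funext fun x => ?_)
  have h1 : ContDiff ℝ ∞ φ.1 := φ.2
  have hs : IsSymmSndFDerivAt ℝ φ.1 x := h1.contDiffAt.isSymmSndFDerivAt (by
    rw [minSmoothness_of_isRCLikeNormedField]; exact WithTop.coe_le_coe.mpr le_top)
  change (dirDeriv v (dirDeriv w φ)).1 x = (dirDeriv w (dirDeriv v φ)).1 x
  rw [key, key, hs.eq]

theorem dirDeriv_eq_sum (v : EuclideanSpace ℝ (Fin n)) :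
    dirDeriv v = ∑ i, v i • dirDeriv (EuclideanSpace.single i (1 : ℝ)) := by
  refine LinearMap.ext fun φ => Subtype.ext (funext fun x => ?_)
  have hv : v = ∑ i, v i • EuclideanSpace.single i (1 : ℝ) := by
    ext j
    simp [Finset.sum_apply, Pi.single_apply]
  rw [dirDeriv_apply]
  conv_lhs => rw [hv]
  rw [map_sum, LinearMap.sum_apply]
  simp only [map_smul, LinearMap.smul_apply, Submodule.coe_sum, Finset.sum_apply,
    Submodule.coe_smul, Pi.smul_apply]
  rfl

/-- `D^α` is an ordered product of powers of the endomorphisms `∂ᵢ`; this gives its smoothness and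
linearity. -/
theorem multiDeriv_eq_list_prod (α : Fin n → ℕ) (φ : smoothFunctions n) :
    multiDeriv α φ.1
      = (((List.finRange n).map fun i =>
          dirDeriv (EuclideanSpace.single i (1 : ℝ)) ^ α i).prod φ).1 := by
  rw [multiDeriv]
  induction List.finRange n with
  | nil => rfl
  | cons i l ih =>
    rw [List.foldr_cons, ih, List.map_cons, List.prod_cons, Module.End.mul_apply]
    set ψ := (l.map fun i => dirDeriv (EuclideanSpace.single i (1 : ℝ)) ^ α i).prod φ
    induction α i with
    | zero => rfl
    | succ k ihk =>
      rw [Function.iterate_succ_apply', ihk, pow_succ', Module.End.mul_apply]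
      rfl

theorem contDiff_multiDeriv (α : Fin n → ℕ) {φ : EuclideanSpace ℝ (Fin n) → ℝ}
    (hφ : ContDiff ℝ ∞ φ) : ContDiff ℝ ∞ (multiDeriv α φ) := by
  rw [multiDeriv_eq_list_prod α ⟨φ, hφ⟩]
  exact Subtype.property _

/-- The multinomial theorem for the commuting operators `v i • ∂ᵢ`: powers of a directional
derivative in terms of multi-index derivatives. -/
theorem dirDeriv_pow_eq_sum (v : EuclideanSpace ℝ (Fin n)) (k : ℕ) (φ : smoothFunctions n)
    (x : EuclideanSpace ℝ (Fin n)) :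
    ((dirDeriv v ^ k) φ).1 x = ∑ α ∈ Finset.piAntidiag Finset.univ k,
      (k.factorial : ℝ) * (multiDeriv α φ.1 x * monomial α v / multiFactorial α) := by
  have hc : ((Finset.univ : Finset (Fin n)) : Set (Fin n)).Pairwise (Function.onFun Commute
      fun i => v i • dirDeriv (EuclideanSpace.single i (1 : ℝ))) := fun i _ j _ _ =>
    ((commute_dirDeriv _ _).smul_left _).smul_right _
  rw [dirDeriv_eq_sum, Finset.sum_pow_eq_sum_piAntidiag_of_commute _ _ hc]
  rw [LinearMap.sum_apply, Submodule.coe_sum, Finset.sum_apply]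
  refine Finset.sum_congr rfl fun α hα => ?_
  have hsum : ∑ i, α i = k := (Finset.mem_piAntidiag.mp hα).1
  have hprod : (Finset.univ : Finset (Fin n)).noncommProd
        (fun i => (v i • dirDeriv (EuclideanSpace.single i (1 : ℝ))) ^ α i)
        (hc.mono' fun _ _ h => h.pow_pow _ _)
      = monomial α v • ((List.finRange n).map fun i =>
          dirDeriv (EuclideanSpace.single i (1 : ℝ)) ^ α i).prod := by
    have h1 : (Finset.univ : Finset (Fin n)).noncommProd
        (fun i => (v i • dirDeriv (EuclideanSpace.single i (1 : ℝ))) ^ α i)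
        (hc.mono' fun _ _ h => h.pow_pow _ _)
        = ((List.finRange n).map fun i =>
          (v i • dirDeriv (EuclideanSpace.single i (1 : ℝ))) ^ α i).prod := by
      rw [Finset.noncommProd]
      exact Multiset.noncommProd_coe _ _
    have h2 : monomial α v = ((List.finRange n).map fun i => v i ^ α i).prod := by
      rw [monomial, ← List.ofFn_eq_map, List.prod_ofFn]
    rw [h1, h2]
    induction List.finRange n with
    | nil => simp
    | cons i l ih =>
      simp only [List.map_cons, List.prod_cons]
      rw [ih, smul_pow, smul_mul_smul_comm]
  have hfac : (k.factorial : ℝ) = multiFactorial α * Nat.multinomial Finset.univ α := by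
    rw [← hsum, ← Nat.multinomial_spec, multiFactorial]
    push_cast
    rfl
  have h0 : (multiFactorial α : ℝ) ≠ 0 := by
    rw [multiFactorial]
    exact_mod_cast Finset.prod_ne_zero_iff.mpr fun i _ => Nat.factorial_ne_zero _
  rw [hprod, ← nsmul_eq_mul, ← Nat.cast_smul_eq_nsmul ℝ, multiDeriv_eq_list_prod, hfac]
  set L := ((List.finRange n).map fun i =>
    dirDeriv (EuclideanSpace.single i (1 : ℝ)) ^ α i).prod
  change (Nat.multinomial Finset.univ α : ℝ) * (monomial α v * (L φ).1 x) = _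
  field_simp

theorem iteratedDeriv_line (φ : smoothFunctions n) (y v : EuclideanSpace ℝ (Fin n)) (k : ℕ) :
    iteratedDeriv k (fun t : ℝ => φ.1 (y + t • v)) = fun t => ((dirDeriv v ^ k) φ).1 (y + t • v) := by
  induction k with
  | zero => simp [iteratedDeriv_zero]
  | succ k ih =>
    rw [iteratedDeriv_succ, ih]
    funext t
    rw [pow_succ', Module.End.mul_apply, dirDeriv_apply]
    set ψ := (dirDeriv v ^ k) φ
    have hψ : ContDiff ℝ ∞ ψ.1 := ψ.2
    have h1 : HasDerivAt (fun t : ℝ => y + t • v) v t := by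
      simpa using ((hasDerivAt_id t).smul_const v).const_add y
    exact ((hψ.differentiable (by simp) _).hasFDerivAt.comp_hasDerivAt t h1).deriv

theorem abs_monomial_le (α : Fin n → ℕ) (v : EuclideanSpace ℝ (Fin n)) :
    |monomial α v| ≤ ‖v‖ ^ order α := by
  rw [monomial, Finset.abs_prod, order, ← Finset.prod_pow_eq_pow_sum]
  refine Finset.prod_le_prod (fun i _ => abs_nonneg _) fun i _ => ?_
  rw [abs_pow]
  exact pow_le_pow_left₀ (abs_nonneg _) (PiLp.norm_apply_le v i) _

theorem tsupport_partialDeriv_subset {φ : EuclideanSpace ℝ (Fin n) → ℝ} (i : Fin n) :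
    tsupport (partialDeriv i φ) ⊆ tsupport φ :=
  tsupport_fderiv_apply_subset ℝ _

theorem tsupport_multiDeriv_subset (α : Fin n → ℕ) (φ : EuclideanSpace ℝ (Fin n) → ℝ) :
    tsupport (multiDeriv α φ) ⊆ tsupport φ := by
  rw [multiDeriv]
  induction List.finRange n with
  | nil => exact subset_rfl
  | cons i l ih =>
    rw [List.foldr_cons]
    refine Subset.trans ?_ ih
    induction α i with
    | zero => exact subset_rfl
    | succ k ihk =>
      rw [Function.iterate_succ_apply']
      exact (tsupport_partialDeriv_subset i).trans ihk

theorem IsTestFunction.multiDeriv {Ω : Set (EuclideanSpace ℝ (Fin n))}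
    {φ : EuclideanSpace ℝ (Fin n) → ℝ} (hφ : IsTestFunction Ω φ) (α : Fin n → ℕ) :
    IsTestFunction Ω (multiDeriv α φ) where
  smooth := contDiff_multiDeriv α hφ.smooth
  compact_support := hφ.compact_support.mono' (subset_tsupport _ |>.trans
    (tsupport_multiDeriv_subset α φ))
  support_subset := (tsupport_multiDeriv_subset α φ).trans hφ.support_subset

theorem sum_multiIndices_eq_sum_piAntidiag (k : ℕ) (F : (Fin n → ℕ) → ℝ) :
    ∑ α ∈ multiIndices n k, F α
      = ∑ j ∈ Finset.range (k + 1), ∑ α ∈ Finset.piAntidiag Finset.univ j, F α := by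
  rw [← Finset.sum_fiberwise_of_maps_to (s := multiIndices n k) (t := Finset.range (k + 1))
    (g := order) fun α hα => Finset.mem_range_succ_iff.mpr (mem_multiIndices.mp hα)]
  refine Finset.sum_congr rfl fun j hj => Finset.sum_congr ?_ fun _ _ => rfl
  ext α
  have := Finset.mem_range_succ_iff.mp hj
  rw [Finset.mem_filter, mem_multiIndices, Finset.mem_piAntidiag]
  constructor
  · rintro ⟨_, h⟩
    exact ⟨h, fun i _ => Finset.mem_univ i⟩
  · rintro ⟨h, _⟩
    exact ⟨h.le.trans this, h⟩

/-- Taylor's theorem in multi-index form, with a remainder bound uniform in the base point. -/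
theorem exists_taylor_bound {φ : EuclideanSpace ℝ (Fin n) → ℝ} (hφ : ContDiff ℝ ∞ φ)
    (hc : HasCompactSupport φ) (m : ℕ) :
    ∃ C : ℝ, 0 ≤ C ∧ ∀ y v : EuclideanSpace ℝ (Fin n),
      |φ (y + v) - ∑ α ∈ multiIndices n m,
        multiDeriv α φ y * monomial α v / multiFactorial α| ≤ C * ‖v‖ ^ (m + 1) := by
  have hb : ∀ α : Fin n → ℕ, ∃ C : ℝ, ∀ x, ‖multiDeriv α φ x‖ ≤ C := fun α =>
    (hc.mono' (subset_tsupport _ |>.trans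
      (tsupport_multiDeriv_subset α φ))).exists_bound_of_continuous
      (contDiff_multiDeriv α hφ).continuous
  choose B hB using hb
  have hB0 : ∀ α, 0 ≤ B α := fun α => (norm_nonneg _).trans (hB α 0)
  set C : ℝ := ∑ α ∈ Finset.piAntidiag (Finset.univ : Finset (Fin n)) (m + 1),
    ((m + 1).factorial : ℝ) * (B α / multiFactorial α) with hC
  have hC0 : 0 ≤ C := Finset.sum_nonneg fun α _ => by have := hB0 α; positivity
  refine ⟨C / m.factorial, by positivity, fun y v => ?_⟩
  let Φ : smoothFunctions n := ⟨φ, hφ⟩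
  set g : ℝ → ℝ := fun t => φ (y + t • v) with hg
  have hgs : ContDiff ℝ ∞ g := hφ.comp (contDiff_const.add (contDiff_id.smul contDiff_const))
  have hid : ∀ k, ∀ t ∈ Icc (0 : ℝ) 1,
      iteratedDerivWithin k g (Icc 0 1) t = ((dirDeriv v ^ k) Φ).1 (y + t • v) := by
    intro k t ht
    rw [iteratedDerivWithin_eq_iteratedDeriv (uniqueDiffOn_Icc zero_lt_one)
      ((hgs.of_le (by exact_mod_cast le_top)).contDiffAt) ht]
    exact congrFun (iteratedDeriv_line Φ y v k) t
  have hbound : ∀ t ∈ Icc (0 : ℝ) 1,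
      ‖iteratedDerivWithin (m + 1) g (Icc 0 1) t‖ ≤ C * ‖v‖ ^ (m + 1) := by
    intro t ht
    rw [hid _ t ht, dirDeriv_pow_eq_sum, hC, Finset.sum_mul]
    refine (norm_sum_le _ _).trans (Finset.sum_le_sum fun α hα => ?_)
    have hord : order α = m + 1 := (Finset.mem_piAntidiag.mp hα).1
    have h1 := abs_monomial_le α v
    rw [hord] at h1
    rw [norm_mul, norm_div, norm_mul, Real.norm_natCast, Real.norm_natCast, mul_assoc,
      div_mul_eq_mul_div, Real.norm_eq_abs (monomial α v)]
    gcongr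
    · exact hB0 α
    · exact hB α _
  have := taylor_mean_remainder_bound (f := g) (n := m) zero_le_one
    (hgs.of_le (by exact_mod_cast le_top)).contDiffOn
    (right_mem_Icc.mpr zero_le_one) hbound
  rw [taylor_within_apply] at this
  rw [sum_multiIndices_eq_sum_piAntidiag]
  have hs : ∑ k ∈ Finset.range (m + 1), ((k.factorial : ℝ)⁻¹ * (1 - 0) ^ k) •
        iteratedDerivWithin k g (Icc 0 1) 0
      = ∑ j ∈ Finset.range (m + 1), ∑ α ∈ Finset.piAntidiag Finset.univ j,
        multiDeriv α φ y * monomial α v / multiFactorial α := by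
    refine Finset.sum_congr rfl fun k _ => ?_
    rw [hid k 0 (left_mem_Icc.mpr zero_le_one), dirDeriv_pow_eq_sum, ← Finset.mul_sum]
    have : (k.factorial : ℝ) ≠ 0 := by positivity
    simp only [sub_zero, one_pow, mul_one, smul_eq_mul, zero_smul, add_zero]
    rw [inv_mul_cancel_left₀ this]
  rw [hs] at this
  simp only [hg, one_smul, sub_zero, one_pow, mul_one, Real.norm_eq_abs] at this
  refine this.trans (le_of_eq ?_)
  ring

end Taylor

/-! ### Polar coordinates and dual polynomials -/

section Polar

variable {n : ℕ}

/-- Integration in polar coordinates of a radial function times a function of the direction. -/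
theorem integral_norm_mul_direction (hn : 1 ≤ n) (f : ℝ → ℝ)
    (Q : EuclideanSpace ℝ (Fin n) → ℝ) :
    ∫ x : EuclideanSpace ℝ (Fin n), f ‖x‖ * Q (‖x‖⁻¹ • x)
      = (∫ θ : Metric.sphere (0 : EuclideanSpace ℝ (Fin n)) 1, Q θ
          ∂(volume : Measure (EuclideanSpace ℝ (Fin n))).toSphere)
        * ∫ r in Ioi (0 : ℝ), f r * r ^ (n - 1) := by
  have : Nonempty (Fin n) := ⟨⟨0, hn⟩⟩
  set μ : Measure (EuclideanSpace ℝ (Fin n)) := volume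
  have hdim : Module.finrank ℝ (EuclideanSpace ℝ (Fin n)) = n := by simp
  calc
    ∫ x, f ‖x‖ * Q (‖x‖⁻¹ • x) ∂μ
        = ∫ x : ({(0)}ᶜ : Set (EuclideanSpace ℝ (Fin n))), f ‖x.1‖ * Q (‖x.1‖⁻¹ • x.1)
            ∂(μ.comap (↑)) := by
      rw [integral_subtype_comap (measurableSet_singleton _).compl
        fun x => f ‖x‖ * Q (‖x‖⁻¹ • x), restrict_compl_singleton]
    _ = ∫ x, Q x.1 * f x.2 ∂μ.toSphere.prod (.volumeIoiPow (n - 1)) := by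
      have h := μ.measurePreserving_homeomorphUnitSphereProd.integral_comp
        (Homeomorph.measurableEmbedding _) (fun x => Q x.1 * f x.2)
      rw [hdim] at h
      rw [← h]
      refine integral_congr_ae (Eventually.of_forall fun x => ?_)
      simp [mul_comm]
    _ = (∫ θ, Q θ ∂μ.toSphere) * ∫ r : Ioi (0 : ℝ), f r ∂.volumeIoiPow (n - 1) :=
      integral_prod_mul (fun θ : Metric.sphere (0 : EuclideanSpace ℝ (Fin n)) 1 => Q θ)
        fun r : Ioi (0 : ℝ) => f r
    _ = _ := by
      congr 1
      simp only [Measure.volumeIoiPow, ENNReal.ofReal]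
      rw [integral_withDensity_eq_integral_smul,
        integral_subtype_comap measurableSet_Ioi fun a => Real.toNNReal (a ^ (n - 1)) • f a,
        setIntegral_congr_fun measurableSet_Ioi fun x hx => ?_]
      · rw [NNReal.smul_def, Real.coe_toNNReal _ (pow_nonneg hx.out.le _), smul_eq_mul, mul_comm]
      · exact (measurable_subtype_coe.pow_const _).real_toNNReal

theorem monomial_smul (α : Fin n → ℕ) (t : ℝ) (x : EuclideanSpace ℝ (Fin n)) :
    monomial α (t • x) = t ^ order α * monomial α x := by
  simp only [monomial, order, PiLp.smul_apply, smul_eq_mul, mul_pow, Finset.prod_mul_distrib,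
    Finset.prod_pow_eq_pow_sum]

theorem continuous_monomial (α : Fin n → ℕ) :
    Continuous (monomial α : EuclideanSpace ℝ (Fin n) → ℝ) := by
  unfold monomial
  fun_prop

/-- Monomials of the same degree are linearly independent as functions on the unit sphere. -/
theorem eq_zero_of_sum_monomial_eq_zero_on_sphere {m : ℕ}
    (c : (Fin n → ℕ) → ℝ)
    (hc : ∀ θ ∈ Metric.sphere (0 : EuclideanSpace ℝ (Fin n)) 1,
      ∑ γ ∈ Finset.piAntidiag Finset.univ m, c γ * monomial γ θ = 0) (hn : 1 ≤ n) :
    ∀ γ ∈ Finset.piAntidiag Finset.univ m, c γ = 0 := by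
  classical
  have : Nonempty (Fin n) := ⟨⟨0, hn⟩⟩
  have hne : ∀ x : EuclideanSpace ℝ (Fin n), x ≠ 0 →
      ∑ γ ∈ Finset.piAntidiag Finset.univ m, c γ * monomial γ x = 0 := by
    intro x hx
    have hx' : ‖x‖ ≠ 0 := norm_ne_zero_iff.mpr hx
    have h1 := hc (‖x‖⁻¹ • x) (by simp [norm_smul, hx'])
    have h2 : ∑ γ ∈ Finset.piAntidiag Finset.univ m, c γ * monomial γ x
        = ‖x‖ ^ m * ∑ γ ∈ Finset.piAntidiag Finset.univ m, c γ * monomial γ (‖x‖⁻¹ • x) := by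
      rw [Finset.mul_sum]
      refine Finset.sum_congr rfl fun γ hγ => ?_
      have hγ' : order γ = m := (Finset.mem_piAntidiag.mp hγ).1
      rw [monomial_smul, hγ', inv_pow]
      field_simp
    rw [h2, h1, mul_zero]
  have hall : ∀ x : EuclideanSpace ℝ (Fin n),
      ∑ γ ∈ Finset.piAntidiag Finset.univ m, c γ * monomial γ x = 0 := by
    have hd : Dense ({0}ᶜ : Set (EuclideanSpace ℝ (Fin n))) := dense_compl_singleton 0
    have hcont : Continuous fun x : EuclideanSpace ℝ (Fin n) =>
        ∑ γ ∈ Finset.piAntidiag Finset.univ m, c γ * monomial γ x :=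
      continuous_finsetSum _ fun γ _ => continuous_const.mul (continuous_monomial γ)
    exact fun x => congrFun (hcont.ext_on hd continuous_const fun y hy => hne y hy) x
  let P : MvPolynomial (Fin n) ℝ := ∑ γ ∈ Finset.piAntidiag Finset.univ m,
    MvPolynomial.monomial (Finsupp.equivFunOnFinite.symm γ) (c γ)
  have hP : P = 0 := by
    refine MvPolynomial.funext fun x => ?_
    rw [map_zero, ← hall (WithLp.toLp 2 x), map_sum]
    refine Finset.sum_congr rfl fun γ _ => ?_
    rw [MvPolynomial.eval_monomial, monomial, Finsupp.prod_fintype _ _ fun i => pow_zero _]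
    rfl
  intro γ hγ
  have h := congrArg (MvPolynomial.coeff (Finsupp.equivFunOnFinite.symm γ)) hP
  rw [MvPolynomial.coeff_sum, MvPolynomial.coeff_zero] at h
  simpa [MvPolynomial.coeff_monomial, hγ] using h

theorem integrable_toSphere_of_continuous {F : EuclideanSpace ℝ (Fin n) → ℝ}
    (hF : Continuous F) :
    Integrable (fun θ : Metric.sphere (0 : EuclideanSpace ℝ (Fin n)) 1 => F θ)
      (volume : Measure (EuclideanSpace ℝ (Fin n))).toSphere := by
  have := (hF.comp continuous_subtype_val : Continuous
    fun θ : Metric.sphere (0 : EuclideanSpace ℝ (Fin n)) 1 => F θ)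
  exact this.integrable_of_hasCompactSupport (HasCompactSupport.of_compactSpace _)

/-- A homogeneous polynomial that is dual to the monomial `x ^ β` among the monomials of the same
degree, for the inner product of `L²` of the unit sphere: their Gram matrix is invertible. -/
theorem exists_dual_polynomial (hn : 1 ≤ n) {m : ℕ} (β : Fin n → ℕ) :
    ∃ c : (Fin n → ℕ) → ℝ, ∀ α ∈ Finset.piAntidiag Finset.univ m,
      ∫ θ : Metric.sphere (0 : EuclideanSpace ℝ (Fin n)) 1,
        monomial α (θ : EuclideanSpace ℝ (Fin n))
          * ∑ γ ∈ Finset.piAntidiag Finset.univ m, c γ * monomial γ (θ : EuclideanSpace ℝ (Fin n))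
        ∂(volume : Measure (EuclideanSpace ℝ (Fin n))).toSphere = if α = β then 1 else 0 := by
  classical
  have : Nonempty (Fin n) := ⟨⟨0, hn⟩⟩
  set σ := (volume : Measure (EuclideanSpace ℝ (Fin n))).toSphere
  set J : Finset (Fin n → ℕ) := Finset.piAntidiag Finset.univ m with hJ
  have hint : ∀ α γ : Fin n → ℕ, Integrable (fun θ : Metric.sphere (0 : EuclideanSpace ℝ (Fin n)) 1
      => monomial α (θ : EuclideanSpace ℝ (Fin n)) * monomial γ (θ : EuclideanSpace ℝ (Fin n))) σ :=
    fun α γ => integrable_toSphere_of_continuous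
      ((continuous_monomial α).mul (continuous_monomial γ))
  let G : Matrix J J ℝ := fun α γ => ∫ θ : Metric.sphere (0 : EuclideanSpace ℝ (Fin n)) 1,
    monomial α.1 (θ : EuclideanSpace ℝ (Fin n)) * monomial γ.1 (θ : EuclideanSpace ℝ (Fin n)) ∂σ
  have hG : ∀ (d : J → ℝ) (c : (Fin n → ℕ) → ℝ), (∀ γ : J, c γ = d γ) → ∀ α : J,
      (G.mulVecLin d) α = ∫ θ : Metric.sphere (0 : EuclideanSpace ℝ (Fin n)) 1,
        monomial α.1 (θ : EuclideanSpace ℝ (Fin n))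
          * ∑ γ ∈ J, c γ * monomial γ (θ : EuclideanSpace ℝ (Fin n)) ∂σ := by
    intro d c hcd α
    simp only [Finset.mul_sum]
    rw [integral_finsetSum _ fun γ _ => by
      simpa only [mul_left_comm] using (hint α.1 γ).const_mul (c γ)]
    rw [← Finset.sum_coe_sort J]
    rw [Matrix.mulVecLin_apply, Matrix.mulVec, dotProduct]
    refine Finset.sum_congr rfl fun γ _ => ?_
    rw [hcd γ, mul_comm, ← integral_const_mul]
    simp only [mul_left_comm]
  let ext : (J → ℝ) → (Fin n → ℕ) → ℝ := fun d γ => if h : γ ∈ J then d ⟨γ, h⟩ else 0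
  have hext : ∀ d (γ : J), ext d γ = d γ := fun d γ => by simp [ext]
  have hinj : Function.Injective G.mulVecLin := by
    rw [injective_iff_map_eq_zero]
    intro d hd
    set F : EuclideanSpace ℝ (Fin n) → ℝ := fun x => ∑ γ ∈ J, ext d γ * monomial γ x with hF
    have hFc : Continuous F :=
      continuous_finsetSum _ fun γ _ => continuous_const.mul (continuous_monomial γ)
    have h0 : ∫ θ : Metric.sphere (0 : EuclideanSpace ℝ (Fin n)) 1, F θ * F θ ∂σ = 0 := by
      have h1 : ∀ θ : Metric.sphere (0 : EuclideanSpace ℝ (Fin n)) 1, F θ * F θ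
          = ∑ α ∈ J, ext d α * (monomial α (θ : EuclideanSpace ℝ (Fin n)) * F θ) := by
        intro θ
        conv_lhs => enter [1]; rw [hF]
        rw [Finset.sum_mul]
        exact Finset.sum_congr rfl fun α _ => mul_assoc _ _ _
      simp only [h1]
      have h2 : ∀ α ∈ J, Integrable (fun θ : Metric.sphere (0 : EuclideanSpace ℝ (Fin n)) 1 =>
          ext d α * (monomial α (θ : EuclideanSpace ℝ (Fin n)) * F θ)) σ := fun α _ =>
        (integrable_toSphere_of_continuous ((continuous_monomial α).mul hFc)).const_mul _
      rw [integral_finsetSum _ h2]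
      refine Finset.sum_eq_zero fun α hα => ?_
      rw [integral_const_mul]
      have := hG d (ext d) (hext d) ⟨α, hα⟩
      rw [hd] at this
      rw [← this]
      simp
    -- a continuous square with zero integral vanishes, as the measure charges every open set
    have hz : (fun θ : Metric.sphere (0 : EuclideanSpace ℝ (Fin n)) 1 => F θ * F θ) = 0 := by
      have hc2 : Continuous fun θ : Metric.sphere (0 : EuclideanSpace ℝ (Fin n)) 1 => F θ * F θ :=
        (hFc.mul hFc).comp continuous_subtype_val
      rw [← hc2.ae_eq_iff_eq σ continuous_zero]
      exact (integral_eq_zero_iff_of_nonneg (fun θ => mul_self_nonneg _)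
        (integrable_toSphere_of_continuous (hFc.mul hFc))).mp h0
    have hcoef := eq_zero_of_sum_monomial_eq_zero_on_sphere (m := m) (ext d)
      (fun θ hθ => mul_self_eq_zero.mp (congrFun hz ⟨θ, hθ⟩)) hn
    funext γ
    rw [← hext d γ]
    exact hcoef γ γ.2
  obtain ⟨d, hd⟩ := LinearMap.surjective_of_injective hinj
    fun α : J => if α.1 = β then (1 : ℝ) else 0
  refine ⟨ext d, fun α hα => ?_⟩
  have := hG d (ext d) (hext d) ⟨α, hα⟩
  rw [hd] at this
  exact this.symm

end Polar

/-! ### Pairing the Taylor remainder with a test function -/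

section Pairing

variable {n : ℕ}

/-- Hölder's inequality for an iterated integral. Only Tonelli's theorem is used, so that no
integrability of the integrand is presupposed. -/
theorem enorm_integral_mul_integral_le {X Y : Type*} [MeasurableSpace X] [MeasurableSpace Y]
    {μ : Measure X} {ν : Measure Y} [SFinite μ] [SFinite ν] {p q : ℝ} (hpq : p.HolderConjugate q)
    {w : X → ℝ} {F : X → Y → ℝ} {a : X → Y → ℝ≥0∞} {b : X → ℝ≥0∞} {c : Y → ℝ≥0∞}
    (ha : Measurable (Function.uncurry a)) (hb : Measurable b) (hc : Measurable c)
    (h : ∀ x y, ‖w x‖ₑ * ‖F x y‖ₑ ≤ a x y * (b x * c y)) :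
    ‖∫ x, w x * ∫ y, F x y ∂ν ∂μ‖ₑ
      ≤ (∫⁻ y, ∫⁻ x, a x y ^ p ∂μ ∂ν) ^ (1 / p)
        * ((∫⁻ x, b x ^ q ∂μ) ^ (1 / q) * (∫⁻ y, c y ^ q ∂ν) ^ (1 / q)) := by
  have hq0 := hpq.symm.pos
  have hbc : Measurable fun z : X × Y => b z.1 * c z.2 :=
    (hb.comp measurable_fst).mul (hc.comp measurable_snd)
  calc ‖∫ x, w x * ∫ y, F x y ∂ν ∂μ‖ₑ
      ≤ ∫⁻ x, ‖w x * ∫ y, F x y ∂ν‖ₑ ∂μ := enorm_integral_le_lintegral_enorm _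
    _ ≤ ∫⁻ x, ∫⁻ y, a x y * (b x * c y) ∂ν ∂μ := by
        refine lintegral_mono fun x => ?_
        rw [enorm_mul]
        refine (mul_le_mul_right (enorm_integral_le_lintegral_enorm _) _).trans ?_
        rw [← lintegral_const_mul' _ _ enorm_ne_top]
        exact lintegral_mono fun y => h x y
    _ = ∫⁻ z, Function.uncurry a z * (b z.1 * c z.2) ∂(μ.prod ν) :=
        (lintegral_prod (fun z : X × Y => Function.uncurry a z * (b z.1 * c z.2))
          (ha.mul hbc).aemeasurable).symm
    _ ≤ (∫⁻ z, Function.uncurry a z ^ p ∂(μ.prod ν)) ^ (1 / p)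
          * (∫⁻ z, (b z.1 * c z.2) ^ q ∂(μ.prod ν)) ^ (1 / q) :=
        ENNReal.lintegral_mul_le_Lp_mul_Lq _ hpq ha.aemeasurable hbc.aemeasurable
    _ = _ := by
        rw [lintegral_prod_symm _ (ha.pow_const p).aemeasurable]
        simp only [ENNReal.mul_rpow_of_nonneg _ _ hq0.le, Function.uncurry_apply_pair]
        rw [lintegral_prod_mul (f := fun x => b x ^ q) (g := fun y => c y ^ q)
          (hb.pow_const q).aemeasurable (hc.pow_const q).aemeasurable,
          ENNReal.mul_rpow_of_nonneg _ _ (one_div_nonneg.mpr hq0.le)]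

/-- The splitting of the integrand used in Hölder's inequality: `k = k^{1/p} k^{1/q}`, and the factor
`r^{-m}` goes with the remainder. -/
theorem enorm_kernel_mul_enorm_le {p q : ℝ} (hpq : p.HolderConjugate q) {k Q A r R φ : ℝ}
    (hk : 0 ≤ k) (hr : 0 ≤ r) (hQ : |Q| ≤ A) (m : ℕ) :
    ‖k * Q / r ^ m‖ₑ * ‖R * φ‖ₑ
      ≤ ENNReal.ofReal (|R| ^ p / r ^ ((m : ℝ) * p) * k) ^ (1 / p)
        * ((ENNReal.ofReal A * ENNReal.ofReal k ^ (1 / q)) * ‖φ‖ₑ) := by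
  have hp0 := hpq.pos
  have hq0 := hpq.symm.pos
  have hA : 0 ≤ A := (abs_nonneg _).trans hQ
  have h1 : (|R| ^ p / r ^ ((m : ℝ) * p) * k) ^ (1 / p) = |R| / r ^ m * k ^ (1 / p) := by
    rw [Real.mul_rpow (by positivity) hk, Real.div_rpow (by positivity) (by positivity),
      ← Real.rpow_mul (abs_nonneg _), ← Real.rpow_mul hr, mul_assoc,
      mul_one_div_cancel hp0.ne', Real.rpow_one, mul_one, Real.rpow_natCast]
  rw [ENNReal.ofReal_rpow_of_nonneg (by positivity) (by positivity), h1, ← enorm_mul,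
    ENNReal.ofReal_rpow_of_nonneg hk (by positivity), ← ENNReal.ofReal_mul hA,
    Real.enorm_eq_ofReal_abs φ, ← ENNReal.ofReal_mul (by positivity),
    ← ENNReal.ofReal_mul (by positivity), Real.enorm_eq_ofReal_abs]
  refine ENNReal.ofReal_le_ofReal ?_
  rw [abs_mul, abs_div, abs_mul, abs_mul, abs_of_nonneg hk, abs_of_nonneg (pow_nonneg hr m)]
  have hkk : k = k ^ (1 / p) * k ^ (1 / q) := by
    rw [← Real.rpow_add_of_nonneg hk (by positivity) (by positivity), one_div, one_div,
      hpq.inv_add_inv_eq_one, Real.rpow_one]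
  calc k * |Q| / r ^ m * (|R| * |φ|) ≤ k * A / r ^ m * (|R| * |φ|) := by gcongr
    _ = _ := by
      conv_lhs => rw [hkk]
      ring

/-- The pairing of a remainder `R` with a test function `φ` is controlled by the energy of `R` and
the `L^q` norm of `φ`. -/
theorem enorm_integral_kernel_mul_le {p q : ℝ} (hpq : p.HolderConjugate q)
    {Ω : Set (EuclideanSpace ℝ (Fin n))} (hΩ : MeasurableSet Ω)
    {φ : EuclideanSpace ℝ (Fin n) → ℝ} (hφ : Measurable φ) {δ : ℝ}
    (hφΩ : ∀ y, φ y ≠ 0 → y ∈ Ω) (hδ : ∀ y h, φ y ≠ 0 → ‖h‖ < δ → y + h ∈ Ω)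
    {k : ℝ → ℝ} (hk : Measurable k) (hk0 : ∀ r, 0 ≤ k r) (hkδ : ∀ r, δ ≤ r → k r = 0)
    {Q : EuclideanSpace ℝ (Fin n) → ℝ} {A : ℝ} (hQA : ∀ h, |Q h| ≤ A)
    {R : EuclideanSpace ℝ (Fin n) → EuclideanSpace ℝ (Fin n) → ℝ}
    (hR : Measurable (Function.uncurry R)) (m : ℕ) :
    ‖∫ h, k ‖h‖ * Q h / ‖h‖ ^ m * ∫ y, R (y + h) y * φ y‖ₑ
      ≤ (∫⁻ y in Ω, ∫⁻ x in Ω,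
            ENNReal.ofReal (|R x y| ^ p / ‖x - y‖ ^ ((m : ℝ) * p) * k ‖x - y‖)) ^ (1 / p)
          * (ENNReal.ofReal A * (∫⁻ h : EuclideanSpace ℝ (Fin n), ENNReal.ofReal (k ‖h‖)) ^ (1 / q)
            * (∫⁻ y, ‖φ y‖ₑ ^ q) ^ (1 / q)) := by
  have hp0 := hpq.pos
  have hq0 := hpq.symm.pos
  have hGm : Measurable fun z : EuclideanSpace ℝ (Fin n) × EuclideanSpace ℝ (Fin n) =>
      ENNReal.ofReal (|R (z.2 + z.1) z.2| ^ p / ‖z.1‖ ^ ((m : ℝ) * p) * k ‖z.1‖) := by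
    have h1 : Measurable fun z : EuclideanSpace ℝ (Fin n) × EuclideanSpace ℝ (Fin n) =>
        ‖z.1‖ := measurable_fst.norm
    have h2 : Measurable fun z : EuclideanSpace ℝ (Fin n) × EuclideanSpace ℝ (Fin n) =>
        R (z.2 + z.1) z.2 := hR.comp ((measurable_snd.add measurable_fst).prodMk measurable_snd)
    exact (((h2.norm.pow_const p).div (h1.pow_const _)).mul (hk.comp h1)).ennreal_ofReal
  have hset : MeasurableSet {y | φ y ≠ 0} := hφ (measurableSet_singleton 0).compl
  have hkm : Measurable fun h : EuclideanSpace ℝ (Fin n) => ENNReal.ofReal (k ‖h‖) :=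
    (hk.comp measurable_norm).ennreal_ofReal
  have key := enorm_integral_mul_integral_le (μ := volume) (ν := volume) hpq
    (w := fun h => k ‖h‖ * Q h / ‖h‖ ^ m) (F := fun h y => R (y + h) y * φ y)
    (a := fun h y => {y | φ y ≠ 0}.indicator (fun y => ENNReal.ofReal
      (|R (y + h) y| ^ p / ‖h‖ ^ ((m : ℝ) * p) * k ‖h‖) ^ (1 / p)) y)
    (b := fun h => ENNReal.ofReal A * ENNReal.ofReal (k ‖h‖) ^ (1 / q))
    (c := fun y => ‖φ y‖ₑ)
    ((hGm.pow_const (1 / p)).indicator (measurable_snd hset))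
    ((hkm.pow_const _).const_mul _) hφ.enorm fun h y => by
      by_cases hy : φ y = 0
      · simp [hy]
      · rw [indicator_of_mem (show y ∈ {y | φ y ≠ 0} from hy)]
        exact enorm_kernel_mul_enorm_le hpq (hk0 _) (norm_nonneg h) (hQA h) m
  refine key.trans (mul_le_mul' (ENNReal.rpow_le_rpow ?_ (by positivity)) (le_of_eq ?_))
  · rw [← lintegral_indicator hΩ]
    refine lintegral_mono fun y => ?_
    -- only `y` in the support of `φ` count; for these `y + h` stays in `Ω` while `|h| < δ`
    by_cases hy : φ y = 0
    · simp [hy, ENNReal.zero_rpow_of_pos hp0]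
    rw [indicator_of_mem (hφΩ y hy)]
    simp only [indicator_of_mem (show y ∈ {y | φ y ≠ 0} from hy), ← ENNReal.rpow_mul,
      one_div_mul_cancel hp0.ne', ENNReal.rpow_one]
    have := lintegral_add_left_eq_self (μ := volume) (fun x => ENNReal.ofReal
      (|R x y| ^ p / ‖x - y‖ ^ ((m : ℝ) * p) * k ‖x - y‖)) y
    simp only [add_sub_cancel_left] at this
    rw [this, ← lintegral_indicator hΩ]
    refine lintegral_mono fun x => ?_
    by_cases hx : x ∈ Ω
    · simp [hx]
    · have h2 : δ ≤ ‖x - y‖ := by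
        by_contra hlt
        exact hx (by simpa using hδ y (x - y) hy (not_le.mp hlt))
      simp [hkδ _ h2]
  · congr 1
    simp only [ENNReal.mul_rpow_of_nonneg _ _ hq0.le, ← ENNReal.rpow_mul,
      one_div_mul_cancel hq0.ne', ENNReal.rpow_one]
    rw [lintegral_const_mul _ hkm, ENNReal.mul_rpow_of_nonneg _ _ (by positivity),
      ← ENNReal.rpow_mul, mul_one_div_cancel hq0.ne', ENNReal.rpow_one]

theorem integrable_mul_testFunction {Ω : Set (EuclideanSpace ℝ (Fin n))}
    {g φ : EuclideanSpace ℝ (Fin n) → ℝ} (hg : LocallyIntegrableOn g Ω volume)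
    (hφ : IsTestFunction Ω φ) : Integrable fun x => g x * φ x := by
  have h1 : IntegrableOn g (tsupport φ) :=
    hg.integrableOn_compact_subset hφ.support_subset hφ.compact_support
  have h2 : IntegrableOn (fun x => g x * φ x) (tsupport φ) :=
    h1.mul_continuousOn hφ.smooth.continuous.continuousOn hφ.compact_support
  refine (integrableOn_iff_integrable_of_support_subset ?_).mp h2
  exact (Function.support_mul_subset_right _ _).trans (subset_tsupport φ)

theorem IsTestFunction.setIntegral_mul_eq {Ω : Set (EuclideanSpace ℝ (Fin n))}
    (g : EuclideanSpace ℝ (Fin n) → ℝ) {φ : EuclideanSpace ℝ (Fin n) → ℝ}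
    (hφ : IsTestFunction Ω φ) : ∫ x in Ω, g x * φ x = ∫ x, g x * φ x := by
  refine setIntegral_eq_integral_of_forall_compl_eq_zero fun x hx => ?_
  rw [image_eq_zero_of_notMem_tsupport fun h => hx (hφ.support_subset h), mul_zero]

theorem IsTestFunction.comp_sub {Ω : Set (EuclideanSpace ℝ (Fin n))}
    {φ : EuclideanSpace ℝ (Fin n) → ℝ} (hφ : IsTestFunction Ω φ) {h : EuclideanSpace ℝ (Fin n)}
    (hh : ∀ y ∈ tsupport φ, y + h ∈ Ω) : IsTestFunction Ω fun y => φ (y - h) where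
  smooth := hφ.smooth.comp (contDiff_id.sub contDiff_const)
  compact_support := hφ.compact_support.comp_homeomorph (Homeomorph.subRight h)
  support_subset := by
    have : tsupport (fun y => φ (y - h)) = (Homeomorph.subRight h) ⁻¹' tsupport φ :=
      tsupport_comp_eq_preimage φ (Homeomorph.subRight h)
    rw [this]
    intro y hy
    simpa using hh (y - h) hy

theorem monomial_neg (α : Fin n → ℕ) (x : EuclideanSpace ℝ (Fin n)) :
    monomial α (-x) = (-1) ^ order α * monomial α x := by
  rw [← monomial_smul, neg_one_smul]

/-- Translation and integration by parts move the Taylor remainder from `f` to the test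
function. -/
theorem integral_remainder_mul_testFunction {Ω : Set (EuclideanSpace ℝ (Fin n))} (k : ℕ)
    {f : EuclideanSpace ℝ (Fin n) → ℝ} {u : (Fin n → ℕ) → EuclideanSpace ℝ (Fin n) → ℝ}
    (hf : LocallyIntegrableOn f Ω volume)
    (hu : ∀ α ∈ multiIndices n k, IsWeakDeriv Ω α f (u α))
    {φ : EuclideanSpace ℝ (Fin n) → ℝ} (hφ : IsTestFunction Ω φ) {h : EuclideanSpace ℝ (Fin n)}
    (hh : ∀ y ∈ tsupport φ, y + h ∈ Ω) :
    ∫ y, (f (y + h) - ∑ α ∈ multiIndices n k, u α y * monomial α h / multiFactorial α) * φ y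
      = ∫ y, f y * (φ (y - h)
        - ∑ α ∈ multiIndices n k, multiDeriv α φ y * monomial α (-h) / multiFactorial α) := by
  have hφh := hφ.comp_sub hh
  have i1 : Integrable fun y => f y * φ (y - h) :=
    integrable_mul_testFunction hf hφh
  have i1' : Integrable fun y => f (y + h) * φ y := by
    simpa using i1.comp_add_right h
  have e1 : ∫ y, f (y + h) * φ y = ∫ y, f y * φ (y - h) := by
    rw [← integral_add_right_eq_self (fun y => f y * φ (y - h)) h]
    simp
  have i2 : ∀ α ∈ multiIndices n k,
      Integrable fun y => u α y * φ y * (monomial α h / multiFactorial α) := fun α hα =>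
    (integrable_mul_testFunction
      (hu α hα).locallyIntegrableOn_deriv hφ).mul_const _
  have i3 : ∀ α ∈ multiIndices n k, Integrable fun y =>
      f y * multiDeriv α φ y * (monomial α (-h) / multiFactorial α) := fun α _ =>
    (integrable_mul_testFunction hf (hφ.multiDeriv α)).mul_const _
  have hl : ∀ y, (f (y + h) - ∑ α ∈ multiIndices n k,
      u α y * monomial α h / multiFactorial α) * φ y = f (y + h) * φ y
        - ∑ α ∈ multiIndices n k, u α y * φ y * (monomial α h / multiFactorial α) := by
    intro y
    rw [sub_mul, Finset.sum_mul]
    congr 1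
    exact Finset.sum_congr rfl fun α _ => by ring
  have hr : ∀ y, f y * (φ (y - h) - ∑ α ∈ multiIndices n k,
      multiDeriv α φ y * monomial α (-h) / multiFactorial α) = f y * φ (y - h)
        - ∑ α ∈ multiIndices n k,
          f y * multiDeriv α φ y * (monomial α (-h) / multiFactorial α) := by
    intro y
    rw [mul_sub, Finset.mul_sum]
    congr 1
    exact Finset.sum_congr rfl fun α _ => by ring
  simp only [hl, hr]
  rw [integral_sub i1' (integrable_finsetSum _ i2), integral_sub i1 (integrable_finsetSum _ i3),
    integral_finsetSum _ i2, integral_finsetSum _ i3, e1]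
  congr 1
  refine Finset.sum_congr rfl fun α hα => ?_
  have h1 := (hu α hα).integral_eq φ hφ
  rw [hφ.setIntegral_mul_eq, (hφ.multiDeriv α).setIntegral_mul_eq] at h1
  rw [integral_mul_const, integral_mul_const, h1, monomial_neg]
  have h2 : ((-1 : ℝ) ^ order α) * (-1) ^ order α = 1 := by
    rw [← mul_pow]; norm_num
  linear_combination (-(∫ y, u α y * φ y) * (monomial α h / multiFactorial α)) * h2

/-- After Taylor expansion of the test function, the pairing of `f` with its remainder is a
homogeneous polynomial in `h` up to higher order. -/
theorem exists_integral_remainder_bound {Ω : Set (EuclideanSpace ℝ (Fin n))} (m : ℕ)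
    {f : EuclideanSpace ℝ (Fin n) → ℝ} (hf : LocallyIntegrableOn f Ω volume)
    {φ : EuclideanSpace ℝ (Fin n) → ℝ} (hφ : IsTestFunction Ω φ) {δ : ℝ}
    (hδ : Metric.cthickening δ (tsupport φ) ⊆ Ω) :
    ∃ C : ℝ, 0 ≤ C ∧ ∀ h : EuclideanSpace ℝ (Fin n), ‖h‖ < δ →
      |(∫ y, f y * (φ (y - h)
          - ∑ α ∈ multiIndices n m, multiDeriv α φ y * monomial α (-h) / multiFactorial α))
        - ∑ α ∈ Finset.piAntidiag Finset.univ (m + 1),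
            (∫ y, f y * multiDeriv α φ y) * (monomial α (-h) / multiFactorial α)|
        ≤ C * ‖h‖ ^ (m + 2) := by
  obtain ⟨C, hC0, hC⟩ := exists_taylor_bound hφ.smooth hφ.compact_support (m + 1)
  set K := Metric.cthickening δ (tsupport φ) with hK
  have hKc : IsCompact K := IsCompact.cthickening hφ.compact_support
  have hfK : IntegrableOn f K := hf.integrableOn_compact_subset hδ hKc
  refine ⟨(∫ y in K, |f y|) * C, mul_nonneg (integral_nonneg fun y => abs_nonneg _) hC0,
    fun h hh => ?_⟩
  have hmem : ∀ y ∈ tsupport φ, y + h ∈ K := fun y hy =>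
    Metric.mem_cthickening_of_dist_le _ y _ _ hy (by simpa using hh.le)
  have hφh := hφ.comp_sub fun y hy => hδ (hmem y hy)
  have i1 : Integrable fun y => f y * φ (y - h) :=
    integrable_mul_testFunction hf hφh
  have i3 : ∀ α : Fin n → ℕ, Integrable fun y =>
      f y * multiDeriv α φ y * (monomial α (-h) / multiFactorial α) := fun α =>
    (integrable_mul_testFunction hf (hφ.multiDeriv α)).mul_const _
  have hr : ∀ y, f y * (φ (y - h) - ∑ α ∈ multiIndices n m,
      multiDeriv α φ y * monomial α (-h) / multiFactorial α) = f y * φ (y - h)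
        - ∑ α ∈ multiIndices n m,
          f y * multiDeriv α φ y * (monomial α (-h) / multiFactorial α) := by
    intro y
    rw [mul_sub, Finset.mul_sum]
    congr 1
    exact Finset.sum_congr rfl fun α _ => by ring
  have i4 : Integrable fun y => f y * (φ (y - h) - ∑ α ∈ multiIndices n m,
      multiDeriv α φ y * monomial α (-h) / multiFactorial α) := by
    simp only [hr]
    exact i1.sub (integrable_finsetSum _ fun α _ => i3 α)
  -- the difference is the pairing of `f` with the remainder of the next order
  have hsum : ∀ F : (Fin n → ℕ) → ℝ, ∑ α ∈ multiIndices n (m + 1), F α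
      = ∑ α ∈ multiIndices n m, F α + ∑ α ∈ Finset.piAntidiag Finset.univ (m + 1), F α := by
    intro F
    rw [sum_multiIndices_eq_sum_piAntidiag, sum_multiIndices_eq_sum_piAntidiag,
      Finset.sum_range_succ _ (m + 1)]
  have heq : (∫ y, f y * (φ (y - h)
        - ∑ α ∈ multiIndices n m, multiDeriv α φ y * monomial α (-h) / multiFactorial α))
        - ∑ α ∈ Finset.piAntidiag Finset.univ (m + 1),
            (∫ y, f y * multiDeriv α φ y) * (monomial α (-h) / multiFactorial α)
      = ∫ y, f y * (φ (y - h) - ∑ α ∈ multiIndices n (m + 1),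
          multiDeriv α φ y * monomial α (-h) / multiFactorial α) := by
    simp only [← integral_mul_const]
    rw [← integral_finsetSum _ fun α _ => i3 α,
      ← integral_sub i4 (integrable_finsetSum _ fun α _ => i3 α)]
    refine integral_congr_ae (Eventually.of_forall fun y => ?_)
    simp only [hsum]
    rw [← sub_sub, mul_sub, mul_sub, mul_sub, sub_right_inj, Finset.mul_sum]
    exact Finset.sum_congr rfl fun α _ => by ring
  rw [heq]
  -- `φ (y - h)` and `D^α φ y` vanish for `y` outside the `δ`-neighbourhood of the support of `φ`
  have hsupp : ∀ y, y ∉ K → f y * (φ (y - h) - ∑ α ∈ multiIndices n (m + 1),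
      multiDeriv α φ y * monomial α (-h) / multiFactorial α) = 0 := by
    intro y hy
    have h1 : φ (y - h) = 0 := by
      refine image_eq_zero_of_notMem_tsupport fun hmem' => hy ?_
      simpa using hmem _ hmem'
    have h2 : ∀ α, multiDeriv α φ y = 0 := fun α => by
      refine image_eq_zero_of_notMem_tsupport fun hmem' => hy ?_
      exact Metric.self_subset_cthickening _ (tsupport_multiDeriv_subset α φ hmem')
    simp [h1, h2]
  rw [← setIntegral_eq_integral_of_forall_compl_eq_zero hsupp, ← Real.norm_eq_abs, mul_assoc,
    ← integral_mul_const]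
  refine norm_integral_le_of_norm_le (hfK.norm.mul_const _) (Eventually.of_forall fun y => ?_)
  rw [norm_mul]
  refine mul_le_mul_of_nonneg_left ?_ (norm_nonneg _)
  have := hC y (-h)
  rwa [norm_neg, ← sub_eq_add_neg] at this

end Pairing

/-! ### Concentration of the mollifiers -/

section Mollifier

variable {n : ℕ}

/-- A null set of radii corresponds to a null set in `ℝⁿ`. -/
theorem ae_norm_eq_of_ae_eq_Ioi (hn : 1 ≤ n) {k k' : ℝ → ℝ}
    (h : k =ᵐ[volume.restrict (Ioi 0)] k') :
    ∀ᵐ x : EuclideanSpace ℝ (Fin n), k ‖x‖ = k' ‖x‖ := by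
  have : Nonempty (Fin n) := ⟨⟨0, hn⟩⟩
  set f : ℝ → ℝ := {r | k r ≠ k' r}.indicator 1 with hf
  have hf0 : ∀ᵐ r ∂(volume.restrict (Ioi (0 : ℝ))), f r = 0 := by
    filter_upwards [h] with r hr
    simp [hf, hr]
  have hint : Integrable fun x : EuclideanSpace ℝ (Fin n) => f ‖x‖ := by
    rw [integrable_fun_norm_addHaar]
    refine (integrable_zero ℝ ℝ _).congr ?_
    filter_upwards [hf0] with r hr
    simp [hr]
  have hzero : ∫ x : EuclideanSpace ℝ (Fin n), f ‖x‖ = 0 := by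
    have := integral_norm_mul_direction hn f fun _ => 1
    simp only [mul_one] at this
    rw [this, integral_eq_zero_of_ae (f := fun r => f r * r ^ (n - 1)), mul_zero]
    filter_upwards [hf0] with r hr
    simp [hr]
  have hnn : ∀ r, 0 ≤ f r := fun r => indicator_nonneg (fun _ _ => zero_le_one) r
  rw [integral_eq_zero_iff_of_nonneg (fun x => hnn ‖x‖) hint] at hzero
  filter_upwards [hzero] with x hx
  by_contra hne
  simp [hf, hne] at hx

/-- The profiles may be taken Borel measurable and nonnegative everywhere. -/
theorem IsRadialMollifier.exists_measurable {ρ : ℝ → ℝ → ℝ} (hρ : IsRadialMollifier n ρ) :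
    ∃ κ : ℝ → ℝ → ℝ, IsRadialMollifier n κ ∧ ∀ ε > 0, Measurable (κ ε) ∧ (∀ r, 0 ≤ κ ε r) ∧
      κ ε =ᵐ[volume.restrict (Ioi 0)] ρ ε := by
  have h : ∀ ε > 0, ∃ k : ℝ → ℝ, Measurable k ∧ (∀ r, 0 ≤ k r) ∧
      k =ᵐ[volume.restrict (Ioi 0)] ρ ε := by
    intro ε hε
    have hm := (hρ.locallyIntegrableOn ε hε).aestronglyMeasurable
    refine ⟨fun r => max 0 (hm.mk _ r), measurable_const.max hm.stronglyMeasurable_mk.measurable,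
      fun r => le_max_left _ _, ?_⟩
    filter_upwards [hm.ae_eq_mk, hρ.nonneg ε hε] with r h1 h2
    rw [← h1, max_eq_right h2]
  choose! κ hκ using h
  refine ⟨κ, ?_, hκ⟩
  have hint : ∀ ε > 0, ∀ δ ≥ 0, ∫ r in Ioi δ, κ ε r * r ^ (n - 1)
      = ∫ r in Ioi δ, ρ ε r * r ^ (n - 1) := by
    intro ε hε δ hδ
    refine integral_congr_ae ?_
    filter_upwards [ae_restrict_of_ae_restrict_of_subset (Ioi_subset_Ioi hδ) (hκ ε hε).2.2]
      with r hr
    rw [hr]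
  refine ⟨fun ε hε => ?_, fun ε hε => Eventually.of_forall (hκ ε hε).2.1, fun ε hε => ?_,
    fun δ hδ => ?_⟩
  · exact (hρ.locallyIntegrableOn ε hε).congr (hκ ε hε).2.2.symm
  · rw [hint ε hε 0 le_rfl, hρ.integral_eq_one ε hε]
  · refine (hρ.tendsto_zero δ hδ).congr' ?_
    filter_upwards [self_mem_nhdsWithin] with ε hε
    exact (hint ε hε δ hδ.le).symm

/-- Integrability follows from `integral_eq_one`, the integral of a function that is not integrable
being `0`. -/
theorem IsRadialMollifier.integrableOn {κ : ℝ → ℝ → ℝ} (hκ : IsRadialMollifier n κ) {ε : ℝ}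
    (hε : 0 < ε) : IntegrableOn (fun r => κ ε r * r ^ (n - 1)) (Ioi 0) := by
  by_contra h
  have := hκ.integral_eq_one ε hε
  rw [integral_undef h] at this
  exact zero_ne_one this

theorem IsRadialMollifier.integral_truncation {κ : ℝ → ℝ → ℝ} (hκ : IsRadialMollifier n κ)
    {ε η : ℝ} (hε : 0 < ε) (hη : 0 < η) :
    ∫ r in Ioi 0, (Iic η).indicator (κ ε) r * r ^ (n - 1)
      = 1 - ∫ r in Ioi η, κ ε r * r ^ (n - 1) := by
  have hint := hκ.integrableOn hε
  have h1 : ∫ r in Ioi 0, (Iic η).indicator (κ ε) r * r ^ (n - 1)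
      = ∫ r in Ioc 0 η, κ ε r * r ^ (n - 1) := by
    simp only [← indicator_mul_left (Iic η) (κ ε) fun r => r ^ (n - 1)]
    rw [setIntegral_indicator measurableSet_Iic, Ioi_inter_Iic]
  rw [h1, eq_sub_iff_add_eq, ← setIntegral_union (Ioc_disjoint_Ioi le_rfl) measurableSet_Ioi
    (hint.mono_set Ioc_subset_Ioi_self) (hint.mono_set (Ioi_subset_Ioi hη.le)),
    Ioc_union_Ioi_eq_Ioi hη.le, hκ.integral_eq_one ε hε]

theorem IsRadialMollifier.tendsto_truncation {κ : ℝ → ℝ → ℝ} (hκ : IsRadialMollifier n κ)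
    {η : ℝ} (hη : 0 < η) :
    Tendsto (fun ε => ∫ r in Ioi 0, (Iic η).indicator (κ ε) r * r ^ (n - 1)) (𝓝[>] 0) (𝓝 1) := by
  have h := (hκ.tendsto_zero η hη).const_sub 1
  rw [sub_zero] at h
  refine h.congr' ?_
  filter_upwards [self_mem_nhdsWithin] with ε hε
  exact (hκ.integral_truncation hε hη).symm

theorem IsRadialMollifier.integrableOn_truncation {κ : ℝ → ℝ → ℝ} (hκ : IsRadialMollifier n κ)
    {ε : ℝ} (η : ℝ) (hε : 0 < ε) :
    IntegrableOn (fun r => (Iic η).indicator (κ ε) r * r ^ (n - 1)) (Ioi 0) := by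
  simp only [← indicator_mul_left (Iic η) (κ ε) fun r => r ^ (n - 1)]
  exact (hκ.integrableOn hε).indicator measurableSet_Iic

theorem IsRadialMollifier.integrableOn_truncation_moment {κ : ℝ → ℝ → ℝ}
    (hκ : IsRadialMollifier n κ) {ε : ℝ} (η : ℝ) (hε : 0 < ε) :
    IntegrableOn (fun r => ((Iic η).indicator (κ ε) r * r) * r ^ (n - 1)) (Ioi 0) := by
  have h1 := hκ.integrableOn_truncation η hε
  refine (h1.const_mul η).mono
    (h1.aestronglyMeasurable.mul measurable_id.aestronglyMeasurable |>.congr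
      (Eventually.of_forall fun r => ?_)) ?_
  · simp only [Pi.mul_apply, id]; ring
  · filter_upwards [ae_restrict_mem measurableSet_Ioi] with r hr
    by_cases h : r ≤ η
    · rw [mul_right_comm, norm_mul, norm_mul η, mul_comm]
      refine mul_le_mul_of_nonneg_right ?_ (norm_nonneg _)
      exact norm_le_norm_of_abs_le_abs (abs_le_abs_of_nonneg (le_of_lt hr) h)
    · simp [h]

/-- The mass of a family of mollifiers concentrates at the origin, so that the first moment of its
truncation vanishes in the limit. -/
theorem IsRadialMollifier.tendsto_truncation_moment {κ : ℝ → ℝ → ℝ}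
    (hκ : IsRadialMollifier n κ) (hκ0 : ∀ ε > 0, ∀ r, 0 ≤ κ ε r) {η : ℝ} (hη : 0 < η) :
    Tendsto (fun ε => ∫ r in Ioi 0, ((Iic η).indicator (κ ε) r * r) * r ^ (n - 1))
      (𝓝[>] 0) (𝓝 0) := by
  rw [Metric.tendsto_nhds]
  intro e he
  have hs : 0 < e / 2 := by positivity
  have h1 := ((hκ.tendsto_zero (e / 2) hs).const_mul η)
  rw [mul_zero] at h1
  filter_upwards [self_mem_nhdsWithin, h1.eventually_lt_const hs] with ε hε hlt
  have hε : 0 < ε := hε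
  have hint := hκ.integrableOn hε
  have hnn : 0 ≤ ∫ r in Ioi 0, ((Iic η).indicator (κ ε) r * r) * r ^ (n - 1) := by
    refine setIntegral_nonneg measurableSet_Ioi fun r hr => ?_
    have hr : 0 < r := hr
    have := indicator_nonneg (s := Iic η) (fun r _ => hκ0 ε hε r) r
    positivity
  rw [Real.dist_eq, sub_zero, abs_of_nonneg hnn]
  have hind : IntegrableOn ((Ioi (e / 2)).indicator fun r => κ ε r * r ^ (n - 1)) (Ioi 0) :=
    hint.indicator measurableSet_Ioi
  calc ∫ r in Ioi 0, ((Iic η).indicator (κ ε) r * r) * r ^ (n - 1)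
      ≤ ∫ r in Ioi 0, (e / 2 * (κ ε r * r ^ (n - 1))
          + η * (Ioi (e / 2)).indicator (fun r => κ ε r * r ^ (n - 1)) r) := by
        refine setIntegral_mono_on (hκ.integrableOn_truncation_moment η hε)
          ((hint.const_mul _).add (hind.const_mul _)) measurableSet_Ioi fun r hr => ?_
        have hr : 0 < r := hr
        have hk := hκ0 ε hε r
        have hkr : 0 ≤ κ ε r * r ^ (n - 1) := by positivity
        by_cases h2 : r ≤ η
        · rw [indicator_of_mem (show r ∈ Iic η from h2)]
          by_cases h3 : e / 2 < r
          · rw [indicator_of_mem (show r ∈ Ioi (e / 2) from h3)]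
            nlinarith
          · rw [indicator_of_notMem (show r ∉ Ioi (e / 2) from h3)]
            nlinarith
        · rw [indicator_of_notMem (show r ∉ Iic η from h2), zero_mul, zero_mul]
          have := indicator_nonneg (s := Ioi (e / 2)) (f := fun r => κ ε r * r ^ (n - 1))
            (fun r hr' => mul_nonneg (hκ0 ε hε r) (pow_nonneg (hs.le.trans (le_of_lt hr')) _)) r
          positivity
    _ = e / 2 + η * ∫ r in Ioi (e / 2), κ ε r * r ^ (n - 1) := by
        rw [integral_add (hint.const_mul _) (hind.const_mul _), integral_const_mul,
          integral_const_mul, hκ.integral_eq_one ε hε, mul_one,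
          setIntegral_indicator measurableSet_Ioi, Ioi_inter_Ioi, max_eq_right hs.le]
    _ < e := by linarith

theorem integrable_comp_norm (hn : 1 ≤ n) {k : ℝ → ℝ}
    (hk : IntegrableOn (fun r => k r * r ^ (n - 1)) (Ioi 0)) :
    Integrable fun h : EuclideanSpace ℝ (Fin n) => k ‖h‖ := by
  have : Nonempty (Fin n) := ⟨⟨0, hn⟩⟩
  rw [integrable_fun_norm_addHaar]
  simpa [mul_comm] using hk

theorem integral_comp_norm (hn : 1 ≤ n) (k : ℝ → ℝ) :
    ∫ h : EuclideanSpace ℝ (Fin n), k ‖h‖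
      = (volume : Measure (EuclideanSpace ℝ (Fin n))).toSphere.real univ
        * ∫ r in Ioi 0, k r * r ^ (n - 1) := by
  have := integral_norm_mul_direction hn k fun _ => 1
  simpa using this

/-- Averages against a dual polynomial extract the corresponding Taylor coefficient in the limit. -/
theorem IsRadialMollifier.tendsto_integral_dual (hn : 1 ≤ n) {κ : ℝ → ℝ → ℝ}
    (hκ : IsRadialMollifier n κ) (hκm : ∀ ε > 0, Measurable (κ ε))
    (hκ0 : ∀ ε > 0, ∀ r, 0 ≤ κ ε r) {m : ℕ} {η δ : ℝ} (hη : 0 < η) (hηδ : η < δ)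
    {P : EuclideanSpace ℝ (Fin n) → ℝ} (hPc : Continuous P) {A : ℝ} (hPA : ∀ h, ‖h‖ ≤ 1 → |P h| ≤ A)
    {β : Fin n → ℕ} (hβ : order β = m)
    (hP : ∀ α ∈ Finset.piAntidiag Finset.univ m,
      ∫ θ : Metric.sphere (0 : EuclideanSpace ℝ (Fin n)) 1,
        monomial α (θ : EuclideanSpace ℝ (Fin n)) * P θ
        ∂(volume : Measure (EuclideanSpace ℝ (Fin n))).toSphere = if α = β then 1 else 0)
    {I : EuclideanSpace ℝ (Fin n) → ℝ} (hI : Measurable I) {a : (Fin n → ℕ) → ℝ} {C : ℝ}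
    (hIa : ∀ h, ‖h‖ < δ →
      |I h - ∑ α ∈ Finset.piAntidiag Finset.univ m, a α * monomial α h| ≤ C * ‖h‖ ^ (m + 1)) :
    Tendsto (fun ε => ∫ h, (Iic η).indicator (κ ε) ‖h‖ * P (‖h‖⁻¹ • h) / ‖h‖ ^ m * I h)
      (𝓝[>] 0) (𝓝 (a β)) := by
  classical
  set σ := (volume : Measure (EuclideanSpace ℝ (Fin n))).toSphere.real univ with hσ
  set J : Finset (Fin n → ℕ) := Finset.piAntidiag Finset.univ m with hJ
  have hdirm : Measurable fun h : EuclideanSpace ℝ (Fin n) => ‖h‖⁻¹ • h :=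
    measurable_norm.inv.smul measurable_id
  have hdir1 : ∀ h : EuclideanSpace ℝ (Fin n), ‖‖h‖⁻¹ • h‖ ≤ 1 := by
    intro h
    rw [norm_smul, norm_inv, norm_norm]
    exact inv_mul_le_one
  have hQA : ∀ h : EuclideanSpace ℝ (Fin n), |P (‖h‖⁻¹ • h)| ≤ A := fun h => hPA _ (hdir1 h)
  have hA : 0 ≤ A := (abs_nonneg _).trans (hQA 0)
  have hβJ : β ∈ J := Finset.mem_piAntidiag.mpr ⟨hβ, fun i _ => Finset.mem_univ i⟩
  have hlim := ((hκ.tendsto_truncation hη).const_mul (a β))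
  rw [mul_one] at hlim
  have herr := ((hκ.tendsto_truncation_moment hκ0 hη).const_mul (A * C * σ))
  rw [mul_zero] at herr
  refine tendsto_of_tendsto_of_dist hlim (squeeze_zero' (Eventually.of_forall fun _ => dist_nonneg)
    ?_ herr)
  filter_upwards [self_mem_nhdsWithin] with ε hε
  have hε : 0 < ε := hε
  set k : ℝ → ℝ := (Iic η).indicator (κ ε) with hk
  have hk0 : ∀ r, 0 ≤ k r := fun r => indicator_nonneg (fun r _ => hκ0 ε hε r) r
  have hkm : Measurable k := (hκm ε hε).indicator measurableSet_Iic
  have hkδ : ∀ r, δ ≤ r → k r = 0 := fun r hr =>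
    indicator_of_notMem (show r ∉ Iic η from fun h => absurd (hηδ.trans_le hr) (not_lt.mpr h)) _
  have hki : Integrable fun h : EuclideanSpace ℝ (Fin n) => k ‖h‖ :=
    integrable_comp_norm hn (hκ.integrableOn_truncation η hε)
  have hki1 : Integrable fun h : EuclideanSpace ℝ (Fin n) => k ‖h‖ * ‖h‖ :=
    integrable_comp_norm (k := fun r => k r * r) hn (hκ.integrableOn_truncation_moment η hε)
  have hQm : Measurable fun h : EuclideanSpace ℝ (Fin n) => P (‖h‖⁻¹ • h) :=
    hPc.measurable.comp hdirm
  have hwm : Measurable fun h : EuclideanSpace ℝ (Fin n) => k ‖h‖ * P (‖h‖⁻¹ • h) / ‖h‖ ^ m :=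
    ((hkm.comp measurable_norm).mul hQm).div (measurable_norm.pow_const m)
  -- the weight `|h|^{-m}` turns a monomial of degree `m` into a function of the direction alone
  have hmon : ∀ α ∈ J, ∀ h : EuclideanSpace ℝ (Fin n),
      k ‖h‖ * P (‖h‖⁻¹ • h) / ‖h‖ ^ m * monomial α h
        = k ‖h‖ * (monomial α (‖h‖⁻¹ • h) * P (‖h‖⁻¹ • h)) := by
    intro α hα h
    have hα' : order α = m := (Finset.mem_piAntidiag.mp hα).1
    rw [monomial_smul, hα', inv_pow, div_eq_mul_inv]
    ring
  have hmain : ∀ α ∈ J, Integrable fun h : EuclideanSpace ℝ (Fin n) =>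
      k ‖h‖ * P (‖h‖⁻¹ • h) / ‖h‖ ^ m * monomial α h := by
    intro α hα
    refine (hki.const_mul A).mono
      (hwm.mul (continuous_monomial α).measurable).aestronglyMeasurable
      (Eventually.of_forall fun h => ?_)
    rw [hmon α hα h, norm_mul, norm_mul A, mul_comm, norm_mul, Real.norm_of_nonneg hA]
    refine mul_le_mul_of_nonneg_right ?_ (norm_nonneg _)
    have h1 : ‖monomial α (‖h‖⁻¹ • h)‖ ≤ 1 :=
      (abs_monomial_le α _).trans (pow_le_one₀ (norm_nonneg _) (hdir1 h))
    calc _ ≤ 1 * A := mul_le_mul h1 (hQA h) (abs_nonneg _) zero_le_one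
      _ = A := one_mul A
  have hpoly : Integrable fun h : EuclideanSpace ℝ (Fin n) =>
      k ‖h‖ * P (‖h‖⁻¹ • h) / ‖h‖ ^ m * ∑ α ∈ J, a α * monomial α h := by
    simp only [Finset.mul_sum, mul_left_comm _ (a _)]
    exact integrable_finsetSum _ fun α hα => (hmain α hα).const_mul _
  have hpolyint : ∫ h : EuclideanSpace ℝ (Fin n),
      k ‖h‖ * P (‖h‖⁻¹ • h) / ‖h‖ ^ m * ∑ α ∈ J, a α * monomial α h
        = a β * ∫ r in Ioi 0, k r * r ^ (n - 1) := by
    simp only [Finset.mul_sum, mul_left_comm _ (a _)]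
    rw [integral_finsetSum _ fun α hα => (hmain α hα).const_mul _,
      Finset.sum_eq_single_of_mem β hβJ]
    · simp only [hmon β hβJ]
      rw [integral_const_mul, integral_norm_mul_direction hn k fun h => monomial β h * P h,
        hP β hβJ, if_pos rfl, one_mul]
    · intro α hα hne
      simp only [hmon α hα]
      rw [integral_const_mul, integral_norm_mul_direction hn k fun h => monomial α h * P h,
        hP α hα, if_neg hne, zero_mul, mul_zero]
  -- the error is at most `A C k(|h|) |h|`, and at `h = 0` both sides vanish
  have hdiffle : ∀ h : EuclideanSpace ℝ (Fin n),
      ‖k ‖h‖ * P (‖h‖⁻¹ • h) / ‖h‖ ^ m * (I h - ∑ α ∈ J, a α * monomial α h)‖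
        ≤ A * C * (k ‖h‖ * ‖h‖) := by
    intro h
    by_cases hδ : ‖h‖ < δ
    · rcases eq_or_ne h 0 with rfl | h0
      · have h1 := hIa 0 hδ
        simp only [norm_zero, ne_eq, Nat.succ_ne_zero, not_false_eq_true, zero_pow, mul_zero] at h1
        have h2 : I 0 - ∑ α ∈ J, a α * monomial α 0 = 0 :=
          abs_eq_zero.mp (le_antisymm h1 (abs_nonneg _))
        simp [h2]
      · have hpos : 0 < ‖h‖ := norm_pos_iff.mpr h0
        have hk' := hk0 ‖h‖
        rw [norm_mul, norm_div, norm_mul, norm_pow, norm_norm, Real.norm_of_nonneg hk',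
          Real.norm_eq_abs, Real.norm_eq_abs]
        calc k ‖h‖ * |P (‖h‖⁻¹ • h)| / ‖h‖ ^ m * |I h - ∑ α ∈ J, a α * monomial α h|
            ≤ k ‖h‖ * A / ‖h‖ ^ m * (C * ‖h‖ ^ (m + 1)) := by
              gcongr
              · exact hQA h
              · exact hIa h hδ
          _ = _ := by
              rw [pow_succ]
              field_simp
    · simp [hkδ _ (not_lt.mp hδ)]
  have hdiff : Integrable fun h : EuclideanSpace ℝ (Fin n) =>
      k ‖h‖ * P (‖h‖⁻¹ • h) / ‖h‖ ^ m * (I h - ∑ α ∈ J, a α * monomial α h) := by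
    refine (hki1.const_mul (A * C)).mono' (hwm.mul (hI.sub ?_)).aestronglyMeasurable
      (Eventually.of_forall hdiffle)
    exact (continuous_finsetSum _ fun α _ =>
      continuous_const.mul (continuous_monomial α)).measurable
  have hsplit : ∫ h, k ‖h‖ * P (‖h‖⁻¹ • h) / ‖h‖ ^ m * I h
      = a β * (∫ r in Ioi 0, k r * r ^ (n - 1))
        + ∫ h, k ‖h‖ * P (‖h‖⁻¹ • h) / ‖h‖ ^ m * (I h - ∑ α ∈ J, a α * monomial α h) := by
    rw [← hpolyint, ← integral_add hpoly hdiff]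
    refine integral_congr_ae (Eventually.of_forall fun h => ?_)
    ring
  rw [hsplit, dist_comm, dist_eq_norm, add_sub_cancel_left]
  refine (norm_integral_le_of_norm_le (hki1.const_mul (A * C))
    (Eventually.of_forall hdiffle)).trans_eq ?_
  rw [integral_const_mul, integral_comp_norm hn fun r => k r * r]
  ring

end Mollifier

/-! ### Boundedness of the distributional derivatives -/

section Recognition

variable {n : ℕ}

theorem multiDeriv_zero (φ : EuclideanSpace ℝ (Fin n) → ℝ) : multiDeriv 0 φ = φ := by
  rw [multiDeriv]
  induction List.finRange n with
  | nil => rfl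
  | cons i l ih => rw [List.foldr_cons, ih]; rfl

theorem isWeakDeriv_zero {Ω : Set (EuclideanSpace ℝ (Fin n))}
    {f : EuclideanSpace ℝ (Fin n) → ℝ} (hf : LocallyIntegrableOn f Ω volume) :
    IsWeakDeriv Ω 0 f f where
  locallyIntegrableOn := hf
  locallyIntegrableOn_deriv := hf
  integral_eq φ _ := by simp [multiDeriv_zero, order]

theorem isWeakDeriv_weakDeriv {Ω : Set (EuclideanSpace ℝ (Fin n))} {α : Fin n → ℕ}
    {f : EuclideanSpace ℝ (Fin n) → ℝ} (hf : LocallyIntegrableOn f Ω volume)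
    (h : ∃ g, IsWeakDeriv Ω α f g) : IsWeakDeriv Ω α f (weakDeriv Ω α f) := by
  rw [weakDeriv]
  split_ifs with h0
  · rw [h0]
    exact isWeakDeriv_zero hf
  · exact h.choose_spec

theorem IsWeakDeriv.congr_ae {Ω : Set (EuclideanSpace ℝ (Fin n))} {α : Fin n → ℕ}
    {f f' g g' : EuclideanSpace ℝ (Fin n) → ℝ} (h : IsWeakDeriv Ω α f g)
    (hf : f =ᵐ[volume.restrict Ω] f') (hg : g =ᵐ[volume.restrict Ω] g') :
    IsWeakDeriv Ω α f' g' where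
  locallyIntegrableOn := h.locallyIntegrableOn.congr hf
  locallyIntegrableOn_deriv := h.locallyIntegrableOn_deriv.congr hg
  integral_eq φ hφ := by
    have h1 : ∫ x in Ω, f' x * multiDeriv α φ x = ∫ x in Ω, f x * multiDeriv α φ x := by
      refine integral_congr_ae ?_
      filter_upwards [hf] with x hx
      rw [hx]
    have h2 : ∫ x in Ω, g' x * φ x = ∫ x in Ω, g x * φ x := by
      refine integral_congr_ae ?_
      filter_upwards [hg] with x hx
      rw [hx]
    rw [h1, h2, h.integral_eq φ hφ]

/-- The energy does not see the choice of representatives, and decreases under truncation of the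
profile. -/
theorem lintegral_remainder_le_remainderEnergy (hn : 1 ≤ n)
    {Ω : Set (EuclideanSpace ℝ (Fin n))} {p : ℝ} {k : ℕ}
    {f f' : EuclideanSpace ℝ (Fin n) → ℝ} {u : (Fin n → ℕ) → EuclideanSpace ℝ (Fin n) → ℝ}
    (hf : f =ᵐ[volume.restrict Ω] f')
    (hu : ∀ α ∈ multiIndices n k, weakDeriv Ω α f =ᵐ[volume.restrict Ω] u α)
    {ρ κ κ' : ℝ → ℝ} (hκ : κ =ᵐ[volume.restrict (Ioi 0)] ρ) (hκ' : ∀ r, κ' r ≤ κ r) :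
    ∫⁻ y in Ω, ∫⁻ x in Ω, ENNReal.ofReal
        (|f' x - ∑ α ∈ multiIndices n k, u α y * monomial α (x - y) / multiFactorial α| ^ p
          / ‖x - y‖ ^ (((k + 1 : ℕ) : ℝ) * p) * κ' ‖x - y‖)
      ≤ remainderEnergy Ω (k + 1) p ρ f := by
  have hu' : ∀ᵐ y ∂(volume.restrict Ω), ∀ α ∈ multiIndices n k, weakDeriv Ω α f y = u α y :=
    (ae_ball_iff (multiIndices n k).countable_toSet).mpr hu
  refine lintegral_mono_ae ?_
  filter_upwards [hu'] with y hy
  have hρ : ∀ᵐ x, κ ‖x - y‖ = ρ ‖x - y‖ :=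
    (measurePreserving_sub_right volume y).quasiMeasurePreserving.ae
      (ae_norm_eq_of_ae_eq_Ioi hn hκ)
  refine lintegral_mono_ae ?_
  filter_upwards [hf, ae_restrict_of_ae hρ] with x hx hxρ
  refine ENNReal.ofReal_le_ofReal ?_
  have h1 : taylorRemainder Ω (k + 1 - 1) f x y
      = f' x - ∑ α ∈ multiIndices n k, u α y * monomial α (x - y) / multiFactorial α := by
    rw [taylorRemainder, taylorPoly, Nat.add_sub_cancel, hx]
    congr 1
    exact Finset.sum_congr rfl fun α hα => by rw [hy α hα]
  rw [h1, ← hxρ]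
  exact mul_le_mul_of_nonneg_left (hκ' _) (by positivity)

theorem IsTestFunction.eLpNorm_restrict_eq {Ω : Set (EuclideanSpace ℝ (Fin n))}
    {φ : EuclideanSpace ℝ (Fin n) → ℝ} (hφ : IsTestFunction Ω φ) {q : ℝ}
    (hq : 0 < q) :
    eLpNorm φ (ENNReal.ofReal q) (volume.restrict Ω) = (∫⁻ y, ‖φ y‖ₑ ^ q) ^ (1 / q) := by
  rw [eLpNorm_restrict_eq_of_support_subset ((subset_tsupport φ).trans hφ.support_subset),
    eLpNorm_eq_lintegral_rpow_enorm_toReal (by simpa using hq) ENNReal.ofReal_ne_top,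
    ENNReal.toReal_ofReal hq.le]

theorem IsTestFunction.memLp {Ω : Set (EuclideanSpace ℝ (Fin n))}
    {φ : EuclideanSpace ℝ (Fin n) → ℝ} (hφ : IsTestFunction Ω φ) (q : ℝ≥0∞) :
    MemLp φ q (volume.restrict Ω) :=
  (hφ.smooth.continuous.memLp_of_hasCompactSupport hφ.compact_support).restrict Ω

/-- Under a bound on the energy, `φ ↦ ∫ f D^β φ` is bounded for the `L^q` norm when `|β| = k + 1`:
it is the limit of pairings of the Taylor remainder of `f` with `φ`. -/
theorem exists_bound_integral_mul_multiDeriv (hn : 1 ≤ n) {Ω : Set (EuclideanSpace ℝ (Fin n))}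
    (hΩ : IsOpen Ω) {p q : ℝ} (hpq : p.HolderConjugate q) {k : ℕ} {ρ : ℝ → ℝ → ℝ}
    (hρ : IsRadialMollifier n ρ) {f : EuclideanSpace ℝ (Fin n) → ℝ}
    (hf : LocallyIntegrableOn f Ω volume)
    (hder : ∀ α : Fin n → ℕ, order α ≤ k → ∃ g, IsWeakDeriv Ω α f g)
    (hfin : liminf (fun ε => remainderEnergy Ω (k + 1) p (ρ ε) f) (𝓝[>] 0) < ⊤)
    {β : Fin n → ℕ} (hβ : order β = k + 1) :
    ∃ B : ℝ, ∀ φ, IsTestFunction Ω φ →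
      |∫ x in Ω, f x * multiDeriv β φ x|
        ≤ B * (eLpNorm φ (ENNReal.ofReal q) (volume.restrict Ω)).toReal := by
  classical
  have hp0 := hpq.pos
  have hq0 := hpq.symm.pos
  obtain ⟨M, hM, hMtop⟩ := exists_between hfin
  have hfreq : ∃ᶠ ε in 𝓝[>] (0 : ℝ), remainderEnergy Ω (k + 1) p (ρ ε) f < M :=
    frequently_lt_of_liminf_lt (by isBoundedDefault) hM
  obtain ⟨κ, hκ, hκρ⟩ := hρ.exists_measurable
  -- Borel representatives of `f` and of its weak derivatives
  have hfm : AEStronglyMeasurable f (volume.restrict Ω) := hf.aestronglyMeasurable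
  set f' := hfm.mk f with hf'
  have hff' : f =ᵐ[volume.restrict Ω] f' := hfm.ae_eq_mk
  have hf'm : Measurable f' := hfm.stronglyMeasurable_mk.measurable
  have hw : ∀ α ∈ multiIndices n k, IsWeakDeriv Ω α f (weakDeriv Ω α f) := fun α hα =>
    isWeakDeriv_weakDeriv hf (hder α (mem_multiIndices.mp hα))
  have hrep : ∀ α ∈ multiIndices n k, ∃ v : EuclideanSpace ℝ (Fin n) → ℝ,
      Measurable v ∧ weakDeriv Ω α f =ᵐ[volume.restrict Ω] v := fun α hα => by
    have h := (hw α hα).locallyIntegrableOn_deriv.aestronglyMeasurable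
    exact ⟨h.mk _, h.stronglyMeasurable_mk.measurable, h.ae_eq_mk⟩
  choose! u hum hu using hrep
  have hfl' : LocallyIntegrableOn f' Ω volume := hf.congr hff'
  have hw' : ∀ α ∈ multiIndices n k, IsWeakDeriv Ω α f' (u α) := fun α hα =>
    (hw α hα).congr_ae hff' (hu α hα)
  let R : EuclideanSpace ℝ (Fin n) → EuclideanSpace ℝ (Fin n) → ℝ := fun x y =>
    f' x - ∑ α ∈ multiIndices n k, u α y * monomial α (x - y) / multiFactorial α
  have hRm : Measurable (Function.uncurry R) := by
    refine (hf'm.comp measurable_fst).sub (Finset.measurable_sum _ fun α hα => ?_)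
    exact (((hum α hα).comp measurable_snd).mul ((continuous_monomial α).measurable.comp
      (measurable_fst.sub measurable_snd))).div_const _
  -- the dual polynomial
  obtain ⟨c, hc⟩ := exists_dual_polynomial hn (m := k + 1) β
  set P : EuclideanSpace ℝ (Fin n) → ℝ := fun h =>
    ∑ γ ∈ Finset.piAntidiag Finset.univ (k + 1), c γ * monomial γ h with hP
  have hPc : Continuous P :=
    continuous_finsetSum _ fun γ _ => continuous_const.mul (continuous_monomial γ)
  set A : ℝ := ∑ γ ∈ Finset.piAntidiag (Finset.univ : Finset (Fin n)) (k + 1), |c γ| with hA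
  have hPA : ∀ h, ‖h‖ ≤ 1 → |P h| ≤ A := by
    intro h hh
    refine (Finset.abs_sum_le_sum_abs _ _).trans (Finset.sum_le_sum fun γ _ => ?_)
    rw [abs_mul]
    exact mul_le_of_le_one_right (abs_nonneg _)
      ((abs_monomial_le γ h).trans (pow_le_one₀ (norm_nonneg _) hh))
  set σ : ℝ := (volume : Measure (EuclideanSpace ℝ (Fin n))).toSphere.real univ with hσ
  set N : ℝ≥0∞ := M ^ (1 / p) * (ENNReal.ofReal A * ENNReal.ofReal σ ^ (1 / q)) with hN
  have hNtop : N ≠ ⊤ := ENNReal.mul_ne_top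
    (ENNReal.rpow_ne_top_of_nonneg (by positivity) hMtop.ne)
    (ENNReal.mul_ne_top ENNReal.ofReal_ne_top
      (ENNReal.rpow_ne_top_of_nonneg (by positivity) ENNReal.ofReal_ne_top))
  refine ⟨multiFactorial β * N.toReal, fun φ hφ => ?_⟩
  obtain ⟨δ, hδ0, hδ⟩ := hφ.compact_support.exists_cthickening_subset_open hΩ hφ.support_subset
  have hmove : ∀ y h, y ∈ tsupport φ → ‖h‖ < δ → y + h ∈ Ω := fun y h hy hh =>
    hδ (Metric.mem_cthickening_of_dist_le _ y _ _ hy (by simpa using hh.le))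
  have hφs : ∀ y, φ y ≠ 0 → y ∈ tsupport φ := fun y hy => subset_tsupport φ hy
  set I : EuclideanSpace ℝ (Fin n) → ℝ := fun h => ∫ y, f' y * (φ (y - h)
    - ∑ α ∈ multiIndices n k, multiDeriv α φ y * monomial α (-h) / multiFactorial α) with hI
  have hIm : Measurable I := by
    have hcont : Continuous fun z : EuclideanSpace ℝ (Fin n) × EuclideanSpace ℝ (Fin n) =>
        φ (z.2 - z.1) - ∑ α ∈ multiIndices n k,
          multiDeriv α φ z.2 * monomial α (-z.1) / multiFactorial α := by
      refine (hφ.smooth.continuous.comp (continuous_snd.sub continuous_fst)).sub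
        (continuous_finsetSum _ fun α _ => ?_)
      exact (((contDiff_multiDeriv α hφ.smooth).continuous.comp continuous_snd).mul
        ((continuous_monomial α).comp continuous_fst.neg)).div_const _
    have : StronglyMeasurable (Function.uncurry fun h y : EuclideanSpace ℝ (Fin n) =>
        f' y * (φ (y - h) - ∑ α ∈ multiIndices n k,
          multiDeriv α φ y * monomial α (-h) / multiFactorial α)) :=
      ((hf'm.comp measurable_snd).mul hcont.measurable).stronglyMeasurable
    exact this.integral_prod_right.measurable
  obtain ⟨C, hC0, hC⟩ := exists_integral_remainder_bound k hfl' hφ hδ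
  -- the profiles are truncated at `δ / 2`, so that they vanish at all radii `r ≥ δ`
  have hη : 0 < δ / 2 := by positivity
  have hlim := hκ.tendsto_integral_dual hn (fun ε hε => (hκρ ε hε).1) (fun ε hε => (hκρ ε hε).2.1)
    hη (half_lt_self hδ0) hPc hPA hβ hc hIm
    (a := fun α => (∫ y, f' y * multiDeriv α φ y) * ((-1) ^ order α / multiFactorial α)) (C := C)
    fun h hh => by
      have h1 := hC h hh
      simp only [monomial_neg] at h1
      refine le_trans (le_of_eq ?_) h1
      congr 2
      simp only [hI, monomial_neg]
      exact Finset.sum_congr rfl fun α _ => by ring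
  -- the pairings are bounded along a sequence of parameters
  have hbound : ∃ᶠ ε in 𝓝[>] (0 : ℝ),
      ‖∫ h, (Iic (δ / 2)).indicator (κ ε) ‖h‖ * P (‖h‖⁻¹ • h) / ‖h‖ ^ (k + 1) * I h‖
        ≤ N.toReal * (eLpNorm φ (ENNReal.ofReal q) (volume.restrict Ω)).toReal := by
    refine (hfreq.and_eventually self_mem_nhdsWithin).mono ?_
    rintro ε ⟨hE, hε⟩
    have hε : 0 < ε := hε
    obtain ⟨hκm, hκ0, hκae⟩ := hκρ ε hε
    set κδ : ℝ → ℝ := (Iic (δ / 2)).indicator (κ ε) with hκδ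
    have hκδ0 : ∀ r, 0 ≤ κδ r := fun r => indicator_nonneg (fun r _ => hκ0 r) r
    have hκδδ : ∀ r, δ ≤ r → κδ r = 0 := fun r hr =>
      indicator_of_notMem (show r ∉ Iic (δ / 2) from fun h =>
        absurd ((half_lt_self hδ0).trans_le hr) (not_lt.mpr h)) _
    have hmass : ∫⁻ h : EuclideanSpace ℝ (Fin n), ENNReal.ofReal (κδ ‖h‖) ≤ ENNReal.ofReal σ := by
      rw [← ofReal_integral_eq_lintegral_ofReal
        (integrable_comp_norm hn (hκ.integrableOn_truncation _ hε))
        (Eventually.of_forall fun h => hκδ0 _)]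
      refine ENNReal.ofReal_le_ofReal ?_
      rw [integral_comp_norm hn κδ, hκ.integral_truncation hε hη]
      refine mul_le_of_le_one_right measureReal_nonneg ?_
      have : 0 ≤ ∫ r in Ioi (δ / 2), κ ε r * r ^ (n - 1) :=
        setIntegral_nonneg measurableSet_Ioi fun r hr =>
          mul_nonneg (hκ0 r) (pow_nonneg (hη.le.trans (le_of_lt hr)) _)
      linarith
    have hJ : ∫ h, κδ ‖h‖ * P (‖h‖⁻¹ • h) / ‖h‖ ^ (k + 1) * I h
        = ∫ h, κδ ‖h‖ * P (‖h‖⁻¹ • h) / ‖h‖ ^ (k + 1) * ∫ y, R (y + h) y * φ y := by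
      refine integral_congr_ae (Eventually.of_forall fun h => ?_)
      by_cases hh : ‖h‖ < δ
      · have := integral_remainder_mul_testFunction k hfl' hw' hφ (h := h)
          fun y hy => hmove y h hy hh
        simp only [hI, R, add_sub_cancel_left]
        rw [this]
      · simp [hκδδ _ (not_lt.mp hh)]
    have hQA : ∀ h : EuclideanSpace ℝ (Fin n), |P (‖h‖⁻¹ • h)| ≤ A := fun h => hPA _ <| by
      rw [norm_smul, norm_inv, norm_norm]
      exact inv_mul_le_one
    have hmain := enorm_integral_kernel_mul_le hpq hΩ.measurableSet hφ.smooth.continuous.measurable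
      (fun y hy => hφ.support_subset (hφs y hy)) (fun y h hy hh => hmove y h (hφs y hy) hh)
      (hκm.indicator measurableSet_Iic) hκδ0 hκδδ hQA hRm (k + 1)
    have hEn := lintegral_remainder_le_remainderEnergy hn (p := p) hff' hu hκae
      (κ' := κδ) fun r => indicator_le_self' (fun r _ => hκ0 r) r
    rw [← hφ.eLpNorm_restrict_eq hq0] at hmain
    have hle : ‖∫ h, κδ ‖h‖ * P (‖h‖⁻¹ • h) / ‖h‖ ^ (k + 1) * I h‖ₑ
        ≤ N * eLpNorm φ (ENNReal.ofReal q) (volume.restrict Ω) := by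
      rw [hJ, hN, mul_assoc]
      refine hmain.trans (mul_le_mul' (ENNReal.rpow_le_rpow (hEn.trans hE.le) (by positivity)) ?_)
      gcongr
    rw [← toReal_enorm, ← ENNReal.toReal_mul]
    exact ENNReal.toReal_mono (ENNReal.mul_ne_top hNtop (hφ.memLp _).2.ne) hle
  have hfinal := le_of_tendsto_of_frequently hlim.norm hbound
  have hint : ∫ x in Ω, f x * multiDeriv β φ x = ∫ y, f' y * multiDeriv β φ y := by
    rw [← (hφ.multiDeriv β).setIntegral_mul_eq]
    refine integral_congr_ae ?_
    filter_upwards [hff'] with x hx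
    rw [hx]
  have hfac : (0 : ℝ) < multiFactorial β := by
    rw [multiFactorial]
    exact_mod_cast Finset.prod_pos fun i _ => Nat.factorial_pos _
  rw [norm_mul, norm_div, norm_pow, norm_neg, norm_one, one_pow, Real.norm_of_nonneg hfac.le,
    mul_one_div, div_le_iff₀ hfac, Real.norm_eq_abs] at hfinal
  rw [hint]
  exact hfinal.trans_eq (by ring)

theorem multiDeriv_add (α : Fin n → ℕ) {φ ψ : EuclideanSpace ℝ (Fin n) → ℝ}
    (hφ : ContDiff ℝ ∞ φ) (hψ : ContDiff ℝ ∞ ψ) :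
    multiDeriv α (φ + ψ) = multiDeriv α φ + multiDeriv α ψ := by
  let Φ : smoothFunctions n := ⟨φ, hφ⟩
  let Ψ : smoothFunctions n := ⟨ψ, hψ⟩
  change multiDeriv α (Φ + Ψ).1 = multiDeriv α Φ.1 + multiDeriv α Ψ.1
  rw [multiDeriv_eq_list_prod, multiDeriv_eq_list_prod, multiDeriv_eq_list_prod, map_add]
  rfl

theorem multiDeriv_smul (α : Fin n → ℕ) (c : ℝ) {φ : EuclideanSpace ℝ (Fin n) → ℝ}
    (hφ : ContDiff ℝ ∞ φ) : multiDeriv α (c • φ) = c • multiDeriv α φ := by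
  let Φ : smoothFunctions n := ⟨φ, hφ⟩
  change multiDeriv α (c • Φ).1 = c • multiDeriv α Φ.1
  rw [multiDeriv_eq_list_prod, multiDeriv_eq_list_prod, map_smul]
  rfl

/-- The space of test functions in `Ω`. -/
def testFunctions (Ω : Set (EuclideanSpace ℝ (Fin n))) :
    Submodule ℝ (EuclideanSpace ℝ (Fin n) → ℝ) where
  carrier := {φ | IsTestFunction Ω φ}
  zero_mem' := ⟨contDiff_const, HasCompactSupport.zero, by simp [tsupport_eq_empty_iff.mpr]⟩
  add_mem' {φ ψ} h1 h2 := ⟨h1.smooth.add h2.smooth, h1.compact_support.add h2.compact_support,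
    (tsupport_add φ ψ).trans (union_subset h1.support_subset h2.support_subset)⟩
  smul_mem' c φ h := ⟨contDiff_const.smul h.smooth, h.compact_support.smul_left,
    (closure_mono (Function.support_const_smul_subset c φ)).trans h.support_subset⟩

/-- A distributional derivative that is bounded for the `L^q` norm is a weak derivative in `L^p`. -/
theorem exists_isWeakDeriv_memLp_of_bound {Ω : Set (EuclideanSpace ℝ (Fin n))}
    {p q : ℝ} (hpq : p.HolderConjugate q) {f : EuclideanSpace ℝ (Fin n) → ℝ}
    (hf : LocallyIntegrableOn f Ω volume) (α : Fin n → ℕ) {B : ℝ}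
    (hB : ∀ φ, IsTestFunction Ω φ → |∫ x in Ω, f x * multiDeriv α φ x|
      ≤ B * (eLpNorm φ (ENNReal.ofReal q) (volume.restrict Ω)).toReal) :
    ∃ g, IsWeakDeriv Ω α f g ∧ MemLp g (ENNReal.ofReal p) (volume.restrict Ω) := by
  have hint : ∀ φ, IsTestFunction Ω φ →
      Integrable (fun x => f x * multiDeriv α φ x) (volume.restrict Ω) := fun φ hφ =>
    (integrable_mul_testFunction hf (hφ.multiDeriv α)).restrict
  let T : testFunctions Ω →ₗ[ℝ] ℝ :=
    { toFun := fun φ => ∫ x in Ω, f x * multiDeriv α φ.1 x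
      map_add' := fun φ ψ => by
        have h1 : IsTestFunction Ω φ.1 := φ.2
        have h2 : IsTestFunction Ω ψ.1 := ψ.2
        rw [← integral_add (hint _ h1) (hint _ h2), Submodule.coe_add,
          multiDeriv_add α h1.smooth h2.smooth]
        simp only [Pi.add_apply, mul_add]
      map_smul' := fun c φ => by
        have h1 : IsTestFunction Ω φ.1 := φ.2
        rw [Submodule.coe_smul, multiDeriv_smul α c h1.smooth, RingHom.id_apply, smul_eq_mul,
          ← integral_const_mul]
        simp only [Pi.smul_apply, smul_eq_mul, mul_left_comm] }
  obtain ⟨g, hg, hTg⟩ := exists_memLp_representation hpq (testFunctions Ω)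
    (fun φ hφ => IsTestFunction.memLp hφ _) T B fun φ => hB φ.1 φ.2
  have hs : ((-1 : ℝ) ^ order α) * (-1) ^ order α = 1 := by
    rw [← mul_pow]; norm_num
  have hg' : MemLp (fun x => (-1) ^ order α * g x) (ENNReal.ofReal p) (volume.restrict Ω) :=
    hg.const_mul _
  have hp1 : 1 ≤ ENNReal.ofReal p := by simpa using hpq.lt.le
  refine ⟨fun x => (-1) ^ order α * g x, ⟨hf, ?_, fun φ hφ => ?_⟩, hg'⟩
  · exact locallyIntegrableOn_of_locallyIntegrable_restrict (hg'.locallyIntegrable hp1)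
  · have h1 : ∫ x in Ω, f x * multiDeriv α φ x = ∫ x in Ω, φ x * g x := hTg ⟨φ, hφ⟩
    rw [h1, ← integral_const_mul]
    refine integral_congr_ae (Eventually.of_forall fun x => ?_)
    linear_combination (-(g x * φ x)) * hs

end Recognition

end HigherSobolev

theorem mainTheorem1 (n : ℕ) (hn : 1 ≤ n) (Ω : Set (EuclideanSpace ℝ (Fin n))) (hΩ : IsOpen Ω)
    (p : ℝ) (hp : 1 < p) (m : ℕ) (hm : 1 ≤ m)
    (ρ : ℝ → ℝ → ℝ) (hρ : HigherSobolev.IsRadialMollifier n ρ)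
    (f : EuclideanSpace ℝ (Fin n) → ℝ) (hf : HigherSobolev.MemSobolev (m - 1) p Ω f)
    (hfin : liminf (fun ε => HigherSobolev.remainderEnergy Ω m p (ρ ε) f) (𝓝[>] 0) < ⊤) :
    HigherSobolev.MemSobolev m p Ω f := by
  obtain ⟨k, rfl⟩ : ∃ k, m = k + 1 := ⟨m - 1, by omega⟩
  rw [Nat.add_sub_cancel] at hf
  have hpq := Real.HolderConjugate.conjExponent hp
  have hfl : LocallyIntegrableOn f Ω volume :=
    locallyIntegrableOn_of_locallyIntegrable_restrict
      (hf.1.locallyIntegrable (by simpa using hp.le))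
  refine ⟨hf.1, fun α hα => ?_⟩
  rcases hα.lt_or_eq with hlt | heq
  · exact hf.2 α (Nat.lt_succ_iff.mp hlt)
  · obtain ⟨B, hB⟩ := HigherSobolev.exists_bound_integral_mul_multiDeriv hn hΩ hpq hρ hfl
      (fun α hα => (hf.2 α hα).imp fun _ h => h.1) hfin heq
    exact HigherSobolev.exists_isWeakDeriv_memLp_of_bound hpq hfl α hB
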